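/- Let $f:[-\pi,\pi]\to\mathbb C$ be a function in $L^1([-\pi,\pi])$, with Fourier coefficients $$f_k=\frac1{2\pi}\int_{-\pi}^{\pi}f(x)\,\mathrm e^{-\mathrm ikx}\,\mathrm dx,\qquad k\in\mathbb Z.$$ Let $T_n(f)=[f_{i-j}]_{i,j=1}^n$, let $Y_n$ be the $n\times n$ exchange matrix (ones on the antidiagonal, zeros elsewhere), and let $H_n(f)=Y_nT_n(f)$. For $g:[0,\pi]\to\mathbb C$ define $\psi_g:[0,2\pi]\to\mathbb C$ by $\psi_g(x)=g(x)$ for $x\in[0,\pi]$ and $\psi_g(x)=-g(x-\pi)$ for $x\in(\pi,2\pi]$. For a sequence of matrices $A_n\in\mathbb C^{d_n\times d_n}$ with $d_n\to\infty$ and a Lebesgue measurable function $g:\Omega\to\mathbb C$ on a Lebesgue measurable set $\Omega\subset\mathbb R$ with $0<\mu(\Omega)<\infty$ ($\mu$ the Lebesgue measure), write $\{A_n\}_n\sim_\lambda g$ if $$\lim_{n\to\infty}\frac1{d_n}\sum_{i=1}^{d_n}F(\lambda_i(A_n))=\frac1{\mu(\Omega)}\int_\Omega F(g(x))\,\mathrm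 dx$$ for every continuous, compactly supported $F:\mathbb C\to\mathbb C$, and write $\{A_n\}_n\sim_\sigma g$ if $$\lim_{n\to\infty}\frac1{d_n}\sum_{i=1}^{d_n}F(\sigma_i(A_n))=\frac1{\mu(\Omega)}\int_\Omega F(|g(x)|)\,\mathrm dx$$ for every continuous, compactly supported $F:\mathbb R\to\mathbb C$. Here $\lambda_i(A_n)$ are the eigenvalues of $A_n$, counted with algebraic multiplicity, and $\sigma_i(A_n)$ are its singular values. Then the following hold. 1. If $f_k\in\mathbb R$ for all $k\in\mathbb Z$, then $$\{T_n(f)\}_n\sim_\sigma f|_{[0,\pi]},\qquad\{H_n(f)\}_n\sim_\sigma f|_{[0,\pi]}.$$ 2. If $f_{-k}=f_k\in\mathbb R$ for all $k\in\mathbb Z$, then $$\{T_n(f)\}_n\sim_\lambda f|_{[0,\pi]},\qquad\{H_n(f)\}_n\sim_\lambda\psi_{f|_{[0,\pi]}},\qquad\{H_n(f)\}_n\sim_\lambda\psi_{|f|_{[0,\pi]}|}.$$ -/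

import Mathlib

open MeasureTheory Filter Topology

noncomputable section

namespace FlippedToeplitz

/-- The `k`-th Fourier coefficient `f_k = (1 / 2π) ∫_{-π}^{π} f(x) e^{-ikx} dx`. -/
def coeff (f : ℝ → ℂ) (k : ℤ) : ℂ :=
  (1 / (2 * (Real.pi : ℂ))) *
    ∫ x in (-Real.pi)..Real.pi, f x * Complex.exp (-(Complex.I * (k : ℂ) * (x : ℂ)))

/-- The `n × n` Toeplitz matrix `T_n(f) = [f_{i-j}]`. -/
def toeplitz (f : ℝ → ℂ) (n : ℕ) : Matrix (Fin n) (Fin n) ℂ :=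
  Matrix.of fun i j => coeff f ((i : ℤ) - (j : ℤ))

/-- The `n × n` exchange (flip) matrix `Y_n`, with ones on the antidiagonal. -/
def exchange (n : ℕ) : Matrix (Fin n) (Fin n) ℂ :=
  Matrix.of fun i j => if j = Fin.rev i then 1 else 0

/-- The flipped Toeplitz matrix `H_n(f) = Y_n T_n(f)`. -/
def flipped (f : ℝ → ℂ) (n : ℕ) : Matrix (Fin n) (Fin n) ℂ :=
  exchange n * toeplitz f n

/-- `∑ F(λ_i(A))` over the eigenvalues of `A`, counted with algebraic multiplicity. -/
def eigenvalueSum {m : ℕ} (F : ℂ → ℂ) (A : Matrix (Fin m) (Fin m) ℂ) : ℂ :=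
  (A.charpoly.roots.map F).sum

/-- `∑ F(σ_i(A))` over the `m` singular values of the `m × m` matrix `A`. -/
def singularValueSum {m : ℕ} (F : ℝ → ℂ) (A : Matrix (Fin m) (Fin m) ℂ) : ℂ :=
  ∑ i : Fin m, F ((Matrix.toEuclideanLin A).singularValues (i : ℕ))

/-- The standing conventions: matrix sizes `d n` tend to infinity, the symbol `f` takes values in
the `k × k` matrices with `k ≥ 1`, and it is a (Lebesgue) measurable function on a measurable
domain `Ω` with `0 < μ(Ω) < ∞`. A function on `Ω` is represented by a function on the whole
space; its values outside `Ω` are never used. -/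
structure IsSymbolSetting {X : Type*} [MeasureSpace X] {k : ℕ} (d : ℕ → ℕ) (Ω : Set X)
    (f : X → Matrix (Fin k) (Fin k) ℂ) : Prop where
  tendsto_size : Tendsto d atTop atTop
  size_pos : 0 < k
  nullMeasurableSet : NullMeasurableSet Ω (volume : Measure X)
  volume_pos : 0 < (volume : Measure X) Ω
  volume_lt_top : (volume : Measure X) Ω < ⊤
  aemeasurable : ∀ i j, AEMeasurable (fun x => f x i j) ((volume : Measure X).restrict Ω)

/-- `{A_n}_n ∼_λ f`, with `f : Ω → ℂ^{k × k}`. -/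
def HasEigenvalueSymbol {X : Type*} [MeasureSpace X] {d : ℕ → ℕ} {k : ℕ}
    (A : (n : ℕ) → Matrix (Fin (d n)) (Fin (d n)) ℂ) (Ω : Set X)
    (f : X → Matrix (Fin k) (Fin k) ℂ) : Prop :=
  IsSymbolSetting d Ω f ∧
    ∀ F : ℂ → ℂ, Continuous F → HasCompactSupport F →
      Tendsto (fun n => (1 / (d n : ℂ)) * eigenvalueSum F (A n)) atTop
        (𝓝 ((1 / ((volume.real Ω : ℝ) : ℂ)) * ∫ x in Ω, eigenvalueSum F (f x) / (k : ℂ)))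

/-- `{A_n}_n ∼_σ f`, with `f : Ω → ℂ^{k × k}`. -/
def HasSingularValueSymbol {X : Type*} [MeasureSpace X] {d : ℕ → ℕ} {k : ℕ}
    (A : (n : ℕ) → Matrix (Fin (d n)) (Fin (d n)) ℂ) (Ω : Set X)
    (f : X → Matrix (Fin k) (Fin k) ℂ) : Prop :=
  IsSymbolSetting d Ω f ∧
    ∀ F : ℝ → ℂ, Continuous F → HasCompactSupport F →
      Tendsto (fun n => (1 / (d n : ℂ)) * singularValueSum F (A n)) atTop
        (𝓝 ((1 / ((volume.real Ω : ℝ) : ℂ)) * ∫ x in Ω, singularValueSum F (f x) / (k : ℂ)))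

/-- A complex-valued function, seen as a function with values in the `1 × 1` matrices. -/
def scalar {X : Type*} (g : X → ℂ) : X → Matrix (Fin 1) (Fin 1) ℂ :=
  fun x => Matrix.of fun _ _ => g x

/-- `ψ_g`, the concatenation of `g` on `[0, π]` and of `x ↦ -g(x - π)` on `(π, 2π]`. It is only
used on `[0, 2π]`, where it only depends on the restriction of `g` to `[0, π]`. -/
def psi (g : ℝ → ℂ) (x : ℝ) : ℂ :=
  if x ≤ Real.pi then g x else -g (x - Real.pi)

end FlippedToeplitz

end

/-! When the Fourier coefficients are real, `flipped f n` is a real Hankel matrix, hence Hermitian.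
The exchange matrix is a Hermitian involution, so `toeplitz f n` and `flipped f n` have the same
Gram matrix, and the singular values of both are the absolute values of the eigenvalues of `flipped
f n`. Everything except the eigenvalue statement for `toeplitz f n` thus follows from one eigenvalue
limit, `tendsto_average_flipped`, whose symbol is the modulus of `f` on the positive half of the
circle and minus the modulus on the negative half.

For a trigonometric polynomial with real coefficients this limit comes from moments. Even powers of
the flipped matrix are powers of a product of two banded Toeplitz matrices, so up to boundedly many
rows they are Toeplitz, with symbol a power of the squared modulus. Odd powers are a flip times a
banded matrix; their trace sees only boundedly many entries, matching the vanishing odd moments of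
an odd symbol. Toeplitz matrices themselves are treated in the same way when the coefficients are
also symmetric.

The passage to integrable symbols uses characteristic functions. By a Duhamel argument
(`norm_trace_exp_sub_le`), the trace of `exp (itA)` moves by at most |t| times the supremum of the
pairings of the difference of the matrices with contractions. For Toeplitz matrices
`norm_trace_toeplitz_mul_le` bounds that pairing by n times the mean of the modulus of the symbol.
Density of trigonometric polynomials in the integrable functions and Lévy's theorem conclude.

Finally, real coefficients force f(-x) to be the conjugate of f(x) almost everywhere, so the circle
folds onto [0, π]. -/

namespace FlippedToeplitz

open scoped Matrix.Norms.L2Operator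

/-! ### Exponential sums of eigenvalues, and convergence of empirical distributions -/

/-- The exponential `exp (t (i A))` of a Hermitian matrix is a contraction. -/
theorem norm_exp_smul_I_smul_le {n : ℕ} {A : Matrix (Fin n) (Fin n) ℂ} (hA : A.IsHermitian)
    (t : ℝ) : ‖NormedSpace.exp (t • (Complex.I • A))‖ ≤ 1 := by
  -- In size 0 the matrix ring is trivial, and its unitaries have norm 0 instead of 1.
  rcases n.eq_zero_or_pos with rfl | hn
  · rw [Subsingleton.elim (NormedSpace.exp (t • (Complex.I • A))) 0]; simp
  have : NeZero n := ⟨hn.ne'⟩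
  have hself : IsSelfAdjoint (t • A) := (IsSelfAdjoint.all t).smul hA
  have h := CStarRing.norm_coe_unitary
    (selfAdjoint.expUnitary (⟨t • A, hself⟩ : selfAdjoint (Matrix (Fin n) (Fin n) ℂ)))
  rw [selfAdjoint.expUnitary_coe] at h
  rw [smul_comm]
  exact h.le

/-- The trace of `exp (i t A)` is the exponential sum over the eigenvalues of `A`. -/
theorem trace_exp_smul_I_smul {n : ℕ} {A : Matrix (Fin n) (Fin n) ℂ} (hA : A.IsHermitian)
    (t : ℝ) :
    (NormedSpace.exp (t • (Complex.I • A))).trace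
      = ∑ i, Complex.exp (t * hA.eigenvalues i * Complex.I) := by
  set U : Matrix (Fin n) (Fin n) ℂ := ↑hA.eigenvectorUnitary with hU
  have hUU : star U * U = 1 := Unitary.coe_star_mul_self hA.eigenvectorUnitary
  have hUU' : U * star U = 1 := Unitary.coe_mul_star_self hA.eigenvectorUnitary
  have hinv : U⁻¹ = star U := Matrix.inv_eq_left_inv hUU
  have hunit : IsUnit U := IsUnit.of_mul_eq_one _ hUU'
  have h : t • (Complex.I • A) = U * Matrix.diagonal
      (fun i => (t * hA.eigenvalues i * Complex.I : ℂ)) * U⁻¹ := by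
    have h1 := hA.spectral_theorem
    rw [Unitary.conjStarAlgAut_apply] at h1
    have h2 : Matrix.diagonal (fun i => (t * hA.eigenvalues i * Complex.I : ℂ))
        = t • (Complex.I • Matrix.diagonal (RCLike.ofReal ∘ hA.eigenvalues)) := by
      ext i j
      by_cases hij : i = j
      · subst hij; simp; ring
      · simp [hij]
    rw [h2, hinv]
    conv_lhs => rw [h1]
    simp [hU, mul_assoc]
  rw [h, Matrix.exp_conj _ _ hunit, Matrix.trace_mul_comm, ← mul_assoc, hinv, hUU, one_mul,
    Matrix.exp_diagonal, Matrix.trace_diagonal]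
  refine Finset.sum_congr rfl fun i _ => ?_
  rw [Pi.coe_exp, Complex.exp_eq_exp_ℂ]

/-- A Duhamel estimate: the trace of the unitary group is controlled by the trace pairing of the
difference of the generators with contractions. -/
theorem norm_trace_exp_sub_le {n : ℕ} {A B : Matrix (Fin n) (Fin n) ℂ} (hA : A.IsHermitian)
    (hB : B.IsHermitian) {δ : ℝ} (hδ : ∀ C, ‖C‖ ≤ 1 → ‖((A - B) * C).trace‖ ≤ δ) (t : ℝ) :
    ‖(NormedSpace.exp (t • (Complex.I • A))).trace
      - (NormedSpace.exp (t • (Complex.I • B))).trace‖ ≤ δ * |t| := by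
  set a := Complex.I • A with ha
  set b := Complex.I • B with hb
  -- The product interpolates between `exp (t • b)` at s = 0 and `exp (t • a)` at s = t. By
  -- cyclicity, the trace of its derivative is i times the pairing of A - B with a product of two
  -- contractions, and the mean value inequality finishes.
  have hd : ∀ s : ℝ, HasDerivAt (fun s : ℝ => NormedSpace.exp (s • a) * NormedSpace.exp ((t - s) • b))
      (NormedSpace.exp (s • a) * a * NormedSpace.exp ((t - s) • b)
        + NormedSpace.exp (s • a) * (-(b * NormedSpace.exp ((t - s) • b)))) s := by
    intro s
    have h1 := hasDerivAt_exp_smul_const (𝕂 := ℝ) a s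
    have h2 := (hasDerivAt_exp_smul_const' (𝕂 := ℝ) b (t - s)).scomp s
      ((hasDerivAt_id s).const_sub t)
    refine (h1.mul h2).congr_deriv ?_
    simp
  have hdt : ∀ s : ℝ, HasDerivAt
      (fun s : ℝ => (NormedSpace.exp (s • a) * NormedSpace.exp ((t - s) • b)).trace)
      (NormedSpace.exp (s • a) * a * NormedSpace.exp ((t - s) • b)
        + NormedSpace.exp (s • a) * (-(b * NormedSpace.exp ((t - s) • b)))).trace s := by
    intro s
    exact ((Matrix.traceLinearMap (Fin n) ℝ ℂ).toContinuousLinearMap.hasFDerivAt).comp_hasDerivAt s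
      (hd s)
  have hbound : ∀ s : ℝ, ‖(NormedSpace.exp (s • a) * a * NormedSpace.exp ((t - s) • b)
        + NormedSpace.exp (s • a) * (-(b * NormedSpace.exp ((t - s) • b)))).trace‖ ≤ δ := by
    intro s
    have h1 : (NormedSpace.exp (s • a) * a * NormedSpace.exp ((t - s) • b)
        + NormedSpace.exp (s • a) * (-(b * NormedSpace.exp ((t - s) • b)))).trace
        = Complex.I * ((A - B) *
          (NormedSpace.exp ((t - s) • b) * NormedSpace.exp (s • a))).trace := by
      have h2 : NormedSpace.exp (s • a) * a * NormedSpace.exp ((t - s) • b)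
        + NormedSpace.exp (s • a) * (-(b * NormedSpace.exp ((t - s) • b)))
          = NormedSpace.exp (s • a) * (Complex.I • ((A - B) * NormedSpace.exp ((t - s) • b))) := by
        rw [← Matrix.smul_mul, smul_sub, ← ha, ← hb, sub_mul, mul_sub, mul_neg, mul_assoc,
          ← sub_eq_add_neg]
      rw [h2, Matrix.trace_mul_comm, Matrix.smul_mul, Matrix.trace_smul, smul_eq_mul, mul_assoc]
    rw [h1, norm_mul, Complex.norm_I, one_mul]
    refine hδ _ ((norm_mul_le _ _).trans ?_)
    exact mul_le_one₀ (norm_exp_smul_I_smul_le hB _) (norm_nonneg _) (norm_exp_smul_I_smul_le hA _)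
  have h := Convex.norm_image_sub_le_of_norm_hasDerivWithin_le (s := Set.univ) (x := 0) (y := t)
    (fun s _ => (hdt s).hasDerivWithinAt) (fun s _ => hbound s) convex_univ trivial trivial
  simpa using h

/-- The exponential sums of the eigenvalues of two Hermitian matrices are close when the
matrices are close in the trace pairing. -/
theorem norm_sum_exp_eigenvalues_sub_le {n : ℕ} {A B : Matrix (Fin n) (Fin n) ℂ}
    (hA : A.IsHermitian) (hB : B.IsHermitian) {δ : ℝ}
    (hδ : ∀ C, ‖C‖ ≤ 1 → ‖((A - B) * C).trace‖ ≤ δ) (t : ℝ) :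
    ‖∑ i, Complex.exp (t * hA.eigenvalues i * Complex.I)
      - ∑ i, Complex.exp (t * hB.eigenvalues i * Complex.I)‖ ≤ δ * |t| := by
  rw [← trace_exp_smul_I_smul, ← trace_exp_smul_I_smul]
  exact norm_trace_exp_sub_le hA hB hδ t

/-- Lévy's continuity theorem for the empirical distributions of a triangular array. -/
theorem tendsto_average_of_tendsto_exp {X : Type*} [MeasurableSpace X] {μ : Measure X}
    [IsProbabilityMeasure μ] {g : X → ℝ} (hg : AEMeasurable g μ) {l : (n : ℕ) → Fin n → ℝ}
    (h : ∀ t : ℝ, Tendsto (fun n : ℕ => (1 / (n : ℂ)) * ∑ i, Complex.exp (t * l n i * Complex.I))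
      atTop (𝓝 (∫ x, Complex.exp (t * g x * Complex.I) ∂μ)))
    {F : ℝ → ℂ} (hF : Continuous F) (hFb : ∃ C, ∀ x, ‖F x‖ ≤ C) :
    Tendsto (fun n : ℕ => (1 / (n : ℂ)) * ∑ i, F (l n i)) atTop (𝓝 (∫ x, F (g x) ∂μ)) := by
  obtain ⟨C, hC⟩ := hFb
  -- The index is shifted by one because the empirical measure of an empty array is not a
  -- probability measure.
  let ν : ℕ → Measure ℝ := fun n =>
    ((n + 1 : ℕ) : ENNReal)⁻¹ • ∑ i, Measure.dirac (l (n + 1) i)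
  have hν : ∀ n, IsProbabilityMeasure (ν n) := fun n => ⟨by
    simp only [ν, Measure.smul_apply, Measure.finsetSum_apply, measure_univ, Finset.sum_const,
      Finset.card_univ, Fintype.card_fin, nsmul_eq_mul, mul_one, smul_eq_mul]
    exact ENNReal.inv_mul_cancel (by simp) (by simp)⟩
  have hint : ∀ (n : ℕ) (G : ℝ → ℂ), ∫ x, G x ∂(ν n)
      = (1 / ((n + 1 : ℕ) : ℂ)) * ∑ i, G (l (n + 1) i) := by
    intro n G
    rw [integral_smul_measure, integral_finsetSum_measure]
    · simp only [integral_dirac, ENNReal.toReal_inv, ENNReal.toReal_natCast, Complex.real_smul,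
        Complex.ofReal_inv, Complex.ofReal_natCast, one_div]
    · intro i _
      exact integrable_dirac (by simp)
  have : IsProbabilityMeasure (μ.map g) := Measure.isProbabilityMeasure_map hg
  let P : ℕ → ProbabilityMeasure ℝ := fun n => ⟨ν n, hν n⟩
  let Q : ProbabilityMeasure ℝ := ⟨μ.map g, inferInstance⟩
  have hP : ∀ n, (P n : Measure ℝ) = ν n := fun n => rfl
  have hQ : (Q : Measure ℝ) = μ.map g := rfl
  have key : Tendsto P atTop (𝓝 Q) := by
    rw [ProbabilityMeasure.tendsto_iff_tendsto_charFun]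
    intro t
    simp only [hP, hQ, charFun_apply_real]
    rw [integral_map hg (by fun_prop)]
    simp_rw [hint]
    exact (tendsto_add_atTop_iff_nat 1).2 (h t)
  rw [ProbabilityMeasure.tendsto_iff_forall_integral_rclike_tendsto ℂ] at key
  have h1 := key (BoundedContinuousFunction.ofNormedAddCommGroup F hF C hC)
  simp only [hP, hQ, BoundedContinuousFunction.coe_ofNormedAddCommGroup] at h1
  rw [integral_map hg hF.aestronglyMeasurable] at h1
  simp_rw [hint] at h1
  exact (tendsto_add_atTop_iff_nat 1).1 h1

/-- Convergence of moments of uniformly bounded arrays gives convergence of exponential sums. -/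
theorem tendsto_exp_of_tendsto_pow {X : Type*} [MeasurableSpace X] {μ : Measure X}
    [IsProbabilityMeasure μ] {g : X → ℝ} (hg : AEMeasurable g μ) {l : (n : ℕ) → Fin n → ℝ}
    {M : ℝ} (hl : ∀ n i, |l n i| ≤ M) (hgM : ∀ x, |g x| ≤ M)
    (h : ∀ k : ℕ, Tendsto (fun n : ℕ => (1 / (n : ℂ)) * ∑ i, ((l n i : ℝ) : ℂ) ^ k)
      atTop (𝓝 (∫ x, ((g x : ℝ) : ℂ) ^ k ∂μ))) (t : ℝ) :
    Tendsto (fun n : ℕ => (1 / (n : ℂ)) * ∑ i, Complex.exp (t * l n i * Complex.I))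
      atTop (𝓝 (∫ x, Complex.exp (t * g x * Complex.I) ∂μ)) := by
  have hexp : ∀ y : ℝ, HasSum (fun k : ℕ => (t * Complex.I) ^ k / (k.factorial : ℂ) * (y : ℂ) ^ k)
      (Complex.exp (t * y * Complex.I)) := by
    intro y
    have := NormedSpace.expSeries_div_hasSum_exp (𝔸 := ℂ) (t * y * Complex.I)
    rw [Complex.exp_eq_exp_ℂ]
    have hk : ∀ k : ℕ, (t * Complex.I) ^ k / (k.factorial : ℂ) * (y : ℂ) ^ k
        = (t * y * Complex.I) ^ k / (k.factorial : ℂ) := fun k => by ring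
    simpa only [hk] using this
  obtain ⟨x₀⟩ : Nonempty X := by
    by_contra hX
    rw [not_nonempty_iff] at hX
    exact IsProbabilityMeasure.ne_zero μ (Measure.eq_zero_of_isEmpty μ)
  have hM : 0 ≤ M := (abs_nonneg _).trans (hgM x₀)
  have hcoef : ∀ k : ℕ, ‖(t * Complex.I) ^ k / (k.factorial : ℂ)‖ = |t| ^ k / k.factorial := by
    intro k; simp
  have hsummable : Summable fun k : ℕ => |t| ^ k / k.factorial * M ^ k := by
    refine (Real.summable_pow_div_factorial (|t| * M)).congr fun k => ?_
    rw [mul_pow, div_mul_eq_mul_div]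
  have hleft : ∀ n : ℕ, (1 / (n : ℂ)) * ∑ i, Complex.exp (t * l n i * Complex.I)
      = ∑' k : ℕ, (t * Complex.I) ^ k / (k.factorial : ℂ)
        * ((1 / (n : ℂ)) * ∑ i, ((l n i : ℝ) : ℂ) ^ k) := by
    intro n
    have h1 := (hasSum_sum (s := Finset.univ) fun i _ => hexp (l n i)).mul_left (1 / (n : ℂ))
    rw [← h1.tsum_eq]
    refine tsum_congr fun k => ?_
    rw [← Finset.mul_sum]
    ring
  have hright : ∫ x, Complex.exp (t * g x * Complex.I) ∂μ
      = ∑' k : ℕ, (t * Complex.I) ^ k / (k.factorial : ℂ) * ∫ x, ((g x : ℝ) : ℂ) ^ k ∂μ := by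
    have h1 := hasSum_integral_of_dominated_convergence (μ := μ)
      (F := fun (k : ℕ) x => (t * Complex.I) ^ k / (k.factorial : ℂ) * ((g x : ℝ) : ℂ) ^ k)
      (f := fun x => Complex.exp (t * g x * Complex.I))
      (fun (k : ℕ) _ => |t| ^ k / k.factorial * M ^ k)
      (fun k => ((Complex.measurable_ofReal.comp_aemeasurable hg).pow_const k
        |>.const_mul _).aestronglyMeasurable)
      (fun k => ae_of_all _ fun x => ?_) (ae_of_all _ fun x => hsummable) (integrable_const _)
      (ae_of_all _ fun x => hexp (g x))
    · rw [← h1.tsum_eq]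
      exact tsum_congr fun k => integral_const_mul _ _
    · rw [norm_mul, hcoef, norm_pow, Complex.norm_real, Real.norm_eq_abs]
      gcongr
      exact hgM x
  rw [hright]
  simp_rw [hleft]
  -- Both sides are now exponential series in the moments. The uniform bound M on the array and on g
  -- supplies the dominating series, so the limit may be taken term by term.
  refine tendsto_tsum_of_dominated_convergence hsummable (fun k => (h k).const_mul _)
    (Eventually.of_forall fun n k => ?_)
  rw [norm_mul, hcoef]
  gcongr
  rcases n.eq_zero_or_pos with rfl | hn
  · simp; positivity
  calc ‖(1 / (n : ℂ)) * ∑ i, ((l n i : ℝ) : ℂ) ^ k‖ ≤ (1 / (n : ℝ)) * ∑ i : Fin n, M ^ k := by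
        rw [norm_mul]
        gcongr
        · simp
        · refine norm_sum_le_of_le _ fun i _ => ?_
          rw [norm_pow, Complex.norm_real, Real.norm_eq_abs]
          gcongr
          exact hl n i
    _ = M ^ k := by
        have : (n : ℝ) ≠ 0 := by positivity
        simp only [Finset.sum_const, Finset.card_univ, Fintype.card_fin, nsmul_eq_mul]
        field_simp

/-- Limits of exponential sums pass to approximating arrays. -/
theorem tendsto_exp_of_approx {X : Type*} [MeasurableSpace X] {μ : Measure X}
    [IsProbabilityMeasure μ] {g : X → ℝ} (hg : AEMeasurable g μ) {l : (n : ℕ) → Fin n → ℝ} (t : ℝ)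
    (h : ∀ ε > 0, ∃ (l' : (n : ℕ) → Fin n → ℝ) (g' : X → ℝ), AEMeasurable g' μ ∧
      (∀ n, ‖∑ i, Complex.exp (t * l n i * Complex.I) - ∑ i, Complex.exp (t * l' n i * Complex.I)‖
        ≤ n * ε) ∧ Integrable (fun x => g x - g' x) μ ∧ ∫ x, |g x - g' x| ∂μ ≤ ε ∧
      Tendsto (fun n : ℕ => (1 / (n : ℂ)) * ∑ i, Complex.exp (t * l' n i * Complex.I))
        atTop (𝓝 (∫ x, Complex.exp (t * g' x * Complex.I) ∂μ))) :
    Tendsto (fun n : ℕ => (1 / (n : ℂ)) * ∑ i, Complex.exp (t * l n i * Complex.I))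
      atTop (𝓝 (∫ x, Complex.exp (t * g x * Complex.I) ∂μ)) := by
  rw [Metric.tendsto_nhds]
  intro δ hδ
  have ht : 0 < |t| + 3 := by positivity
  -- Three errors are added: ε from the arrays, less than ε from the limit for l', and |t|ε from the
  -- symbols. Their sum is below (|t| + 3)ε = δ.
  obtain ⟨l', g', hg', hl', hint, hgg, hlim⟩ := h (δ / (|t| + 3)) (by positivity)
  set ε := δ / (|t| + 3) with hε
  have hεpos : 0 < ε := by positivity
  have hδε : δ = ε * (|t| + 3) := by rw [hε]; field_simp
  rw [Metric.tendsto_nhds] at hlim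
  filter_upwards [hlim ε hεpos] with n hn
  have h1 : dist ((1 / (n : ℂ)) * ∑ i, Complex.exp (t * l n i * Complex.I))
      ((1 / (n : ℂ)) * ∑ i, Complex.exp (t * l' n i * Complex.I)) ≤ ε := by
    rw [dist_eq_norm, ← mul_sub, norm_mul]
    rcases n.eq_zero_or_pos with rfl | hn0
    · simpa using hεpos.le
    have hn1 : (0 : ℝ) < n := by exact_mod_cast hn0
    have : ‖(1 / (n : ℂ))‖ = 1 / n := by simp
    rw [this, one_div, inv_mul_le_iff₀ hn1]
    exact hl' n
  have hexpint : ∀ u : X → ℝ, AEMeasurable u μ →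
      Integrable (fun x => Complex.exp (t * u x * Complex.I)) μ := by
    intro u hu
    refine Integrable.of_bound (C := 1) ?_ (ae_of_all _ fun x => ?_)
    · exact (((Complex.measurable_ofReal.comp_aemeasurable hu).const_mul _).mul_const _).cexp
        |>.aestronglyMeasurable
    · rw [← Complex.ofReal_mul, Complex.norm_exp_ofReal_mul_I]
  have h2 : dist (∫ x, Complex.exp (t * g' x * Complex.I) ∂μ)
      (∫ x, Complex.exp (t * g x * Complex.I) ∂μ) ≤ |t| * ε := by
    rw [dist_comm, dist_eq_norm, ← integral_sub (hexpint g hg) (hexpint g' hg')]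
    calc ‖∫ x, (Complex.exp (t * g x * Complex.I) - Complex.exp (t * g' x * Complex.I)) ∂μ‖
        ≤ ∫ x, |t| * |g x - g' x| ∂μ := by
          refine norm_integral_le_of_norm_le (hint.abs.const_mul _) (ae_of_all _ fun x => ?_)
          have : Complex.exp (t * g x * Complex.I) - Complex.exp (t * g' x * Complex.I)
              = Complex.exp ((t * g' x : ℝ) * Complex.I)
                * (Complex.exp (Complex.I * (t * (g x - g' x) : ℝ)) - 1) := by
            rw [mul_sub, ← Complex.exp_add, mul_one]
            push_cast
            congr 2
            ring
          rw [this, norm_mul, Complex.norm_exp_ofReal_mul_I, one_mul, ← abs_mul]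
          exact Real.norm_exp_I_mul_ofReal_sub_one_le
      _ ≤ |t| * ε := by
          rw [integral_const_mul]
          gcongr
  have h3 := dist_triangle4_right
    ((1 / (n : ℂ)) * ∑ i, Complex.exp (t * l n i * Complex.I))
    (∫ x, Complex.exp (t * g x * Complex.I) ∂μ)
    ((1 / (n : ℂ)) * ∑ i, Complex.exp (t * l' n i * Complex.I))
    (∫ x, Complex.exp (t * g' x * Complex.I) ∂μ)
  rw [dist_comm (∫ x, Complex.exp (t * g x * Complex.I) ∂μ)] at h3
  nlinarith

end FlippedToeplitz

/-! ### Banded Toeplitz matrices, their trace moments, and spectra of Hermitian matrices -/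

namespace FlippedToeplitz

open scoped LaurentPolynomial

/-- The Toeplitz matrix `[c (i - j)]`. -/
def toep (c : ℤ → ℂ) (n : ℕ) : Matrix (Fin n) (Fin n) ℂ :=
  Matrix.of fun i j => c ((i : ℤ) - (j : ℤ))

theorem toep_apply (c : ℤ → ℂ) {n : ℕ} (i j : Fin n) : toep c n i j = c ((i : ℤ) - (j : ℤ)) := rfl

theorem exchange_mul_apply {n : ℕ} (A : Matrix (Fin n) (Fin n) ℂ) (i j : Fin n) :
    (exchange n * A) i j = A (Fin.rev i) j := by
  simp [exchange, Matrix.mul_apply]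

theorem mul_exchange_apply {n : ℕ} (A : Matrix (Fin n) (Fin n) ℂ) (i j : Fin n) :
    (A * exchange n) i j = A i (Fin.rev j) := by
  have h : ∀ k : Fin n, (j = Fin.rev k) ↔ (k = Fin.rev j) := fun k => by
    constructor <;> rintro rfl <;> simp
  simp [exchange, Matrix.mul_apply, h]

theorem exchange_mul_self (n : ℕ) : exchange n * exchange n = 1 := by
  ext i j
  rw [exchange_mul_apply]
  simp [exchange, Matrix.one_apply, eq_comm]

theorem conjTranspose_exchange (n : ℕ) : (exchange n).conjTranspose = exchange n := by
  ext i j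
  have h : (i = Fin.rev j) ↔ (j = Fin.rev i) := by constructor <;> rintro rfl <;> simp
  simp [exchange, Matrix.conjTranspose_apply, h, apply_ite]

theorem cast_rev {n : ℕ} (i : Fin n) : ((Fin.rev i : Fin n) : ℤ) = n - 1 - i := by
  have := i.2
  rw [Fin.val_rev]
  omega

/-- A Hankel matrix with real entries is Hermitian. -/
theorem isHermitian_exchange_mul_toep {c : ℤ → ℂ} (hc : ∀ k, (c k).im = 0) (n : ℕ) :
    (exchange n * toep c n).IsHermitian := by
  ext i j
  rw [Matrix.conjTranspose_apply, exchange_mul_apply, exchange_mul_apply, toep_apply, toep_apply,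
    cast_rev, cast_rev, Complex.star_def, Complex.conj_eq_iff_im.2 (hc _)]
  congr 1
  ring

theorem isHermitian_toep {c : ℤ → ℂ} (hc : ∀ k, (c k).im = 0) (hs : ∀ k, c (-k) = c k) (n : ℕ) :
    (toep c n).IsHermitian := by
  ext i j
  rw [Matrix.conjTranspose_apply, toep_apply, toep_apply, Complex.star_def,
    Complex.conj_eq_iff_im.2 (hc _), ← hs, neg_sub]

theorem coeff_invert (p : ℂ[T;T⁻¹]) (k : ℤ) :
    (LaurentPolynomial.invert p).coeff k = p.coeff (-k) := by
  simp

/-- Conjugation by the exchange matrix reverses both indices, so it negates i - j and replaces the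
symbol p(z) by p(1/z). -/
theorem flipped_sq_toep (p : ℂ[T;T⁻¹]) (n : ℕ) :
    (exchange n * toep p.coeff n) ^ 2
      = toep (LaurentPolynomial.invert p).coeff n * toep p.coeff n := by
  have h : exchange n * toep p.coeff n * exchange n
      = toep (LaurentPolynomial.invert p).coeff n := by
    ext i j
    rw [mul_exchange_apply, exchange_mul_apply, toep_apply, toep_apply, coeff_invert, cast_rev,
      cast_rev]
    congr 1
    ring
  rw [sq, ← mul_assoc, h]

/-- A sequence of uniformly banded, uniformly bounded matrices which coincides with the Toeplitz
matrices of `p` away from boundedly many rows. -/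
def IsNearlyToeplitz (A : (n : ℕ) → Matrix (Fin n) (Fin n) ℂ) (p : ℂ[T;T⁻¹]) : Prop :=
  ∃ (N : ℕ) (C : ℝ), (∀ k : ℤ, (N : ℤ) < |k| → p.coeff k = 0) ∧ ∀ (n : ℕ) (i : Fin n),
    (∀ j : Fin n, N ≤ (i : ℕ) → (i : ℕ) + N < n → A n i j = p.coeff ((i : ℤ) - (j : ℤ))) ∧
    (∀ j : Fin n, (N : ℤ) < |(i : ℤ) - (j : ℤ)| → A n i j = 0) ∧ ∑ j, ‖A n i j‖ ≤ C

/-- Within a row, j ↦ i - j is injective, so each coefficient occurs at most once. The bound does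
not depend on n, which also keeps the eigenvalues in a fixed interval. -/
theorem sum_norm_toep_le (p : ℂ[T;T⁻¹]) {n : ℕ} (i : Fin n) :
    ∑ j, ‖toep p.coeff n i j‖ ≤ ∑ k ∈ p.coeff.support, ‖p.coeff k‖ := by
  have hinj : Function.Injective fun j : Fin n => (i : ℤ) - (j : ℤ) := by
    intro a b hab
    have : (a : ℤ) = b := by simpa using hab
    exact Fin.ext (by exact_mod_cast this)
  calc ∑ j, ‖toep p.coeff n i j‖
      = ∑ k ∈ Finset.univ.image (fun j : Fin n => (i : ℤ) - (j : ℤ)), ‖p.coeff k‖ := by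
        rw [Finset.sum_image hinj.injOn]
        rfl
    _ ≤ ∑ k ∈ Finset.univ.image (fun j : Fin n => (i : ℤ) - (j : ℤ)) ∪ p.coeff.support,
          ‖p.coeff k‖ :=
        Finset.sum_le_sum_of_subset_of_nonneg Finset.subset_union_left fun _ _ _ => norm_nonneg _
    _ = ∑ k ∈ p.coeff.support, ‖p.coeff k‖ := by
        refine (Finset.sum_subset Finset.subset_union_right fun k _ hk => ?_).symm
        rw [Finsupp.notMem_support_iff.1 hk, norm_zero]

theorem exists_coeff_eq_zero (p : ℂ[T;T⁻¹]) :
    ∃ N : ℕ, ∀ k : ℤ, (N : ℤ) < |k| → p.coeff k = 0 := by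
  refine ⟨∑ k ∈ p.coeff.support, k.natAbs, fun k hk => ?_⟩
  by_contra h
  have h1 : k.natAbs ≤ ∑ k ∈ p.coeff.support, k.natAbs := Finset.single_le_sum
    (f := fun k : ℤ => k.natAbs) (fun _ _ => Nat.zero_le _) (Finsupp.mem_support_iff.2 h)
  rw [Int.abs_eq_natAbs] at hk
  omega

theorem isNearlyToeplitz_toep (p : ℂ[T;T⁻¹]) :
    IsNearlyToeplitz (fun n => toep p.coeff n) p := by
  obtain ⟨N, hN⟩ := exists_coeff_eq_zero p
  exact ⟨N, _, hN, fun n i => ⟨fun j _ _ => rfl, fun j hj => hN _ hj, sum_norm_toep_le p i⟩⟩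

theorem coeff_one_apply (k : ℤ) : (1 : ℂ[T;T⁻¹]).coeff k = if k = 0 then 1 else 0 := by
  rw [AddMonoidAlgebra.one_def, AddMonoidAlgebra.coeff_single, Finsupp.single_apply]
  simp only [eq_comm]

theorem isNearlyToeplitz_one : IsNearlyToeplitz (fun _ => 1) 1 := by
  refine ⟨0, 1, fun k hk => ?_, fun n i => ⟨fun j _ _ => ?_, fun j hj => ?_, ?_⟩⟩
  · have : k ≠ 0 := by rintro rfl; simp at hk
    rw [coeff_one_apply, if_neg this]
  · have : (i : ℤ) - (j : ℤ) = 0 ↔ i = j := by rw [sub_eq_zero, Fin.ext_iff]; norm_cast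
    simp only [coeff_one_apply, Matrix.one_apply, this]
  · have : i ≠ j := by rintro rfl; simp at hj
    simp [this]
  · simp [Matrix.one_apply, apply_ite]

theorem coeff_mul_eq_sum (p q : ℂ[T;T⁻¹]) (m : ℤ) :
    (p * q).coeff m = ∑ a ∈ p.coeff.support, p.coeff a * q.coeff (m - a) := by
  classical
  rw [AddMonoidAlgebra.coeff_mul]
  simp only [Finsupp.sum]
  refine Finset.sum_congr rfl fun a _ => ?_
  rw [Finset.sum_eq_single (m - a)]
  · simp
  · intro b _ hb
    rw [if_neg]
    intro h
    exact hb (by omega)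
  · intro h
    simp [Finsupp.notMem_support_iff.1 h]

/-- Matrix multiplication truncates the convolution of the coefficients. Nothing is lost when every
exponent of p is reached from row i by some column, which is the case far enough from the borders.
-/
theorem sum_coeff_mul_coeff {p q : ℂ[T;T⁻¹]} {n : ℕ} (i j : Fin n)
    (hp : ∀ a ∈ p.coeff.support, ∃ k : Fin n, (i : ℤ) - (k : ℤ) = a) :
    ∑ k : Fin n, p.coeff ((i : ℤ) - (k : ℤ)) * q.coeff ((k : ℤ) - (j : ℤ))
      = (p * q).coeff ((i : ℤ) - (j : ℤ)) := by
  have hinj : Function.Injective fun j : Fin n => (i : ℤ) - (j : ℤ) := by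
    intro a b hab
    have : (a : ℤ) = b := by simpa using hab
    exact Fin.ext (by exact_mod_cast this)
  rw [coeff_mul_eq_sum, Finset.sum_subset (s₂ := Finset.univ.image
    (fun j : Fin n => (i : ℤ) - (j : ℤ))), Finset.sum_image hinj.injOn]
  · refine Finset.sum_congr rfl fun k _ => ?_
    congr 2
    ring
  · intro a ha
    obtain ⟨k, hk⟩ := hp a ha
    exact Finset.mem_image.2 ⟨k, Finset.mem_univ _, hk⟩
  · intro a _ ha
    rw [Finsupp.notMem_support_iff.1 ha, zero_mul]

/-- Band widths add and row-sum bounds multiply. In a row at distance N₁ + N₂ from the borders, A is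
Toeplitz and involves only rows of B within N₁ of it, where B is still Toeplitz. -/
theorem IsNearlyToeplitz.mul {A B : (n : ℕ) → Matrix (Fin n) (Fin n) ℂ} {p q : ℂ[T;T⁻¹]}
    (hA : IsNearlyToeplitz A p) (hB : IsNearlyToeplitz B q) :
    IsNearlyToeplitz (fun n => A n * B n) (p * q) := by
  obtain ⟨N₁, C₁, hp, hA⟩ := hA
  obtain ⟨N₂, C₂, hq, hB⟩ := hB
  refine ⟨N₁ + N₂, C₁ * C₂, fun k hk => ?_, fun n i => ⟨fun j h1 h2 => ?_, fun j hj => ?_, ?_⟩⟩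
  · rw [coeff_mul_eq_sum]
    refine Finset.sum_eq_zero fun a _ => ?_
    by_cases ha : (N₁ : ℤ) < |a|
    · rw [hp a ha, zero_mul]
    · rw [hq (k - a), mul_zero]
      have := abs_add_le (k - a) a
      rw [sub_add_cancel] at this
      push_cast at hk
      omega
  · beta_reduce
    rw [← sum_coeff_mul_coeff, Matrix.mul_apply]
    · refine Finset.sum_congr rfl fun k _ => ?_
      rw [(hA n i).1 k (by omega) (by omega)]
      by_cases hk : (N₁ : ℤ) < |(i : ℤ) - (k : ℤ)|
      · rw [hp _ hk, zero_mul, zero_mul]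
      · rw [not_lt, abs_le] at hk
        rw [(hB n k).1 j (by omega) (by omega)]
    · intro a ha
      have ha' : ¬ (N₁ : ℤ) < |a| := fun h => Finsupp.mem_support_iff.1 ha (hp a h)
      rw [not_lt, abs_le] at ha'
      exact ⟨⟨((i : ℤ) - a).toNat, by omega⟩, by simp only; omega⟩
  · beta_reduce
    rw [Matrix.mul_apply]
    refine Finset.sum_eq_zero fun k _ => ?_
    by_cases hk : (N₁ : ℤ) < |(i : ℤ) - (k : ℤ)|
    · rw [(hA n i).2.1 k hk, zero_mul]
    · rw [(hB n k).2.1 j, mul_zero]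
      have := abs_add_le ((i : ℤ) - k) (k - j)
      rw [sub_add_sub_cancel] at this
      push_cast at hj
      omega
  · have hC₂ : 0 ≤ C₂ := (Finset.sum_nonneg fun _ _ => norm_nonneg _).trans (hB n i).2.2
    calc ∑ j, ‖(A n * B n) i j‖ ≤ ∑ j, ∑ k, ‖A n i k‖ * ‖B n k j‖ := by
          refine Finset.sum_le_sum fun j _ => ?_
          rw [Matrix.mul_apply]
          exact (norm_sum_le _ _).trans (Finset.sum_le_sum fun k _ => (norm_mul _ _).le)
      _ = ∑ k, ‖A n i k‖ * ∑ j, ‖B n k j‖ := by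
          rw [Finset.sum_comm]
          simp_rw [Finset.mul_sum]
      _ ≤ ∑ k, ‖A n i k‖ * C₂ :=
          Finset.sum_le_sum fun k _ => mul_le_mul_of_nonneg_left (hB n k).2.2 (norm_nonneg _)
      _ ≤ C₁ * C₂ := by
          rw [← Finset.sum_mul]
          exact mul_le_mul_of_nonneg_right (hA n i).2.2 hC₂

theorem IsNearlyToeplitz.pow {A : (n : ℕ) → Matrix (Fin n) (Fin n) ℂ} {p : ℂ[T;T⁻¹]}
    (hA : IsNearlyToeplitz A p) (k : ℕ) : IsNearlyToeplitz (fun n => A n ^ k) (p ^ k) := by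
  induction k with
  | zero => simpa using isNearlyToeplitz_one
  | succ k ih => simpa only [pow_succ] using ih.mul hA

theorem tendsto_one_div_mul_of_bounded {x : ℕ → ℂ} {K : ℝ} (hx : ∀ n, ‖x n‖ ≤ K) :
    Tendsto (fun n : ℕ => (1 / (n : ℂ)) * x n) atTop (𝓝 0) := by
  rw [tendsto_zero_iff_norm_tendsto_zero]
  have h : Tendsto (fun n : ℕ => (1 / (n : ℝ)) * K) atTop (𝓝 0) := by
    simpa using tendsto_one_div_atTop_nhds_zero_nat.mul_const K
  refine squeeze_zero (fun _ => norm_nonneg _) (fun n => ?_) h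
  rw [norm_mul]
  have : ‖(1 / (n : ℂ))‖ = 1 / n := by simp
  rw [this]
  exact mul_le_mul_of_nonneg_left (hx n) (by positivity)

theorem norm_apply_le_of_sum_norm_le {n : ℕ} {A : Matrix (Fin n) (Fin n) ℂ} {C : ℝ} (i j : Fin n)
    (h : ∑ j, ‖A i j‖ ≤ C) : ‖A i j‖ ≤ C :=
  (Finset.single_le_sum (f := fun j => ‖A i j‖) (fun _ _ => norm_nonneg _)
    (Finset.mem_univ j)).trans h

/-- Normalized traces of nearly Toeplitz matrices converge to the mean of the symbol. -/
theorem IsNearlyToeplitz.tendsto_trace {A : (n : ℕ) → Matrix (Fin n) (Fin n) ℂ} {p : ℂ[T;T⁻¹]}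
    (hA : IsNearlyToeplitz A p) :
    Tendsto (fun n : ℕ => (1 / (n : ℂ)) * (A n).trace) atTop (𝓝 (p.coeff 0)) := by
  obtain ⟨N, C, -, hA⟩ := hA
  have hb : ∀ n, ‖(A n).trace - n * p.coeff 0‖ ≤ (2 * N) * (|C| + ‖p.coeff 0‖) := by
    intro n
    have h1 : (A n).trace - n * p.coeff 0 = ∑ i, (A n i i - p.coeff 0) := by
      simp [Matrix.trace]
    -- Only the first N and the last N rows can differ from the Toeplitz pattern.
    have hcard : (Finset.univ.filter fun i : Fin n => ¬ (N ≤ (i : ℕ) ∧ (i : ℕ) + N < n)).card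
        ≤ 2 * N := by
      rw [← Finset.card_map Fin.valEmbedding]
      calc _ ≤ (Finset.range N ∪ Finset.Ico (n - N) n).card := by
            refine Finset.card_le_card fun a ha => ?_
            simp only [Finset.mem_map, Finset.mem_filter, Finset.mem_univ, true_and,
              Fin.valEmbedding_apply] at ha
            obtain ⟨i, hi, rfl⟩ := ha
            have := i.2
            simp only [Finset.mem_union, Finset.mem_range, Finset.mem_Ico]
            omega
        _ ≤ _ := (Finset.card_union_le _ _).trans (by simp; omega)
    rw [h1, ← Finset.sum_filter_add_sum_filter_not Finset.univ
      (fun i : Fin n => N ≤ (i : ℕ) ∧ (i : ℕ) + N < n), Finset.sum_eq_zero, zero_add]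
    · refine (norm_sum_le_of_le _ (f := fun i => A n i i - p.coeff 0)
        (n := fun _ => |C| + ‖p.coeff 0‖) fun i _ => ?_).trans ?_
      · refine (norm_sub_le _ _).trans (add_le_add_left ?_ _)
        exact (norm_apply_le_of_sum_norm_le i i (hA n i).2.2).trans (le_abs_self C)
      · rw [Finset.sum_const, nsmul_eq_mul]
        gcongr
        exact_mod_cast hcard
    · intro i hi
      rw [Finset.mem_filter] at hi
      rw [(hA n i).1 i hi.2.1 hi.2.2, sub_self, sub_self]
  have h := (tendsto_one_div_mul_of_bounded hb).add_const (p.coeff 0)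
  rw [zero_add] at h
  refine h.congr' ?_
  filter_upwards [eventually_ne_atTop 0] with n hn
  have : (n : ℂ) ≠ 0 := by exact_mod_cast hn
  field_simp
  ring

/-- Normalized traces of flipped nearly Toeplitz matrices vanish in the limit. -/
theorem IsNearlyToeplitz.tendsto_trace_exchange_mul {A : (n : ℕ) → Matrix (Fin n) (Fin n) ℂ}
    {p : ℂ[T;T⁻¹]} (hA : IsNearlyToeplitz A p) :
    Tendsto (fun n : ℕ => (1 / (n : ℂ)) * (exchange n * A n).trace) atTop (𝓝 0) := by
  obtain ⟨N, C, -, hA⟩ := hA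
  refine tendsto_one_div_mul_of_bounded (K := (2 * N + 1) * |C|) fun n => ?_
  -- The entry (rev i, i) lies on the diagonal of index n - 1 - 2i. These indices are distinct for
  -- distinct i, so at most 2N + 1 of them fall inside the band.
  have hcard : (Finset.univ.filter fun i : Fin n => |(n : ℤ) - 1 - 2 * i| ≤ N).card
      ≤ 2 * N + 1 := by
    have hinj : Function.Injective fun i : Fin n => (n : ℤ) - 1 - 2 * i := by
      intro a b hab
      have : (a : ℤ) = b := by simp only at hab; omega
      exact Fin.ext (by exact_mod_cast this)
    rw [← Finset.card_map ⟨_, hinj⟩]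
    calc _ ≤ (Finset.Icc (-N : ℤ) N).card := by
          refine Finset.card_le_card fun a ha => ?_
          simp only [Finset.mem_map, Finset.mem_filter, Finset.mem_univ, true_and,
            Function.Embedding.coeFn_mk] at ha
          obtain ⟨i, hi, rfl⟩ := ha
          exact Finset.mem_Icc.2 (abs_le.1 hi)
      _ ≤ _ := by simp; omega
  have h1 : (exchange n * A n).trace = ∑ i, A n (Fin.rev i) i := by
    simp only [Matrix.trace, Matrix.diag_apply, exchange_mul_apply]
  rw [h1, ← Finset.sum_filter_add_sum_filter_not Finset.univ
    (fun i : Fin n => |(n : ℤ) - 1 - 2 * i| ≤ N), Finset.sum_eq_zero (s := Finset.univ.filter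
      fun i : Fin n => ¬ |(n : ℤ) - 1 - 2 * i| ≤ N), add_zero]
  · refine (norm_sum_le_of_le _ (f := fun i => A n (Fin.rev i) i) (n := fun _ => |C|)
      fun i _ => ?_).trans ?_
    · exact (norm_apply_le_of_sum_norm_le _ i (hA n _).2.2).trans (le_abs_self C)
    · rw [Finset.sum_const, nsmul_eq_mul]
      gcongr
      exact_mod_cast hcard
  · intro i hi
    rw [Finset.mem_filter, not_le] at hi
    refine (hA n _).2.1 i ?_
    rw [cast_rev, sub_sub (_ - 1), ← two_mul]
    exact hi.2

theorem tendsto_trace_toep_pow (p : ℂ[T;T⁻¹]) (k : ℕ) :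
    Tendsto (fun n : ℕ => (1 / (n : ℂ)) * (toep p.coeff n ^ k).trace) atTop
      (𝓝 ((p ^ k).coeff 0)) :=
  ((isNearlyToeplitz_toep p).pow k).tendsto_trace

theorem tendsto_trace_flipped_pow_even (p : ℂ[T;T⁻¹]) (k : ℕ) :
    Tendsto (fun n : ℕ => (1 / (n : ℂ)) * ((exchange n * toep p.coeff n) ^ (2 * k)).trace) atTop
      (𝓝 (((LaurentPolynomial.invert p * p) ^ k).coeff 0)) := by
  simp_rw [pow_mul, flipped_sq_toep]
  exact (((isNearlyToeplitz_toep _).mul (isNearlyToeplitz_toep p)).pow k).tendsto_trace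

theorem tendsto_trace_flipped_pow_odd (p : ℂ[T;T⁻¹]) (k : ℕ) :
    Tendsto (fun n : ℕ => (1 / (n : ℂ)) * ((exchange n * toep p.coeff n) ^ (2 * k + 1)).trace) atTop
      (𝓝 0) := by
  simp_rw [pow_succ', pow_mul, flipped_sq_toep, mul_assoc]
  exact ((isNearlyToeplitz_toep p).mul
    (((isNearlyToeplitz_toep _).mul (isNearlyToeplitz_toep p)).pow k)).tendsto_trace_exchange_mul

section linfty

attribute [local instance] Matrix.linftyOpNormedAddCommGroup Matrix.linftyOpNormedRing
  Matrix.linftyOpNormedAlgebra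

/-- The eigenvalues of a Hermitian matrix are bounded by its absolute row sums. -/
theorem abs_eigenvalues_le {n : ℕ} {A : Matrix (Fin n) (Fin n) ℂ} (hA : A.IsHermitian) {M : ℝ}
    (hM : ∀ i, ∑ j, ‖A i j‖ ≤ M) (i : Fin n) : |hA.eigenvalues i| ≤ M := by
  have : NeZero n := ⟨fun h => by subst h; exact i.elim0⟩
  have h0 : 0 ≤ M := (Finset.sum_nonneg fun _ _ => norm_nonneg _).trans (hM i)
  -- The spectrum is bounded by the matrix norm, which in this section is the ℓ^∞ operator norm, the
  -- largest absolute row sum.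
  have h1 := spectrum.norm_le_norm_of_mem (hA.eigenvalues_mem_spectrum_real i)
  refine h1.trans ?_
  rw [Matrix.linfty_opNorm_def]
  lift M to NNReal using h0
  rw [NNReal.coe_le_coe]
  refine Finset.sup_le fun j _ => ?_
  rw [← NNReal.coe_le_coe]
  push_cast
  exact hM j

end linfty

theorem sum_eigenvalues_pow {n : ℕ} {A : Matrix (Fin n) (Fin n) ℂ} (hA : A.IsHermitian) (k : ℕ) :
    ∑ i, ((hA.eigenvalues i : ℝ) : ℂ) ^ k = (A ^ k).trace := by
  have h1 := hA.spectral_theorem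
  conv_rhs => rw [h1]
  rw [← map_pow, Unitary.conjStarAlgAut_apply, Matrix.trace_mul_comm, ← mul_assoc,
    Unitary.coe_star_mul_self, one_mul, Matrix.diagonal_pow, Matrix.trace_diagonal]
  simp

theorem eigenvalueSum_eq {n : ℕ} {A : Matrix (Fin n) (Fin n) ℂ} (hA : A.IsHermitian) (F : ℂ → ℂ) :
    eigenvalueSum F A = ∑ i, F (hA.eigenvalues i) := by
  rw [eigenvalueSum, hA.roots_charpoly_eq_eigenvalues, Multiset.map_map]
  rfl

/-- Singular values are the square roots of the eigenvalues of the Gram matrix. In this form their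
ordering disappears and matrices with equal Gram matrices become interchangeable. -/
theorem singularValueSum_eq_roots {n : ℕ} (A : Matrix (Fin n) (Fin n) ℂ) (F : ℝ → ℂ) :
    singularValueSum F A
      = ((A.conjTranspose * A).charpoly.roots.map fun z => F (Real.sqrt z.re)).sum := by
  have hn : Module.finrank ℂ (EuclideanSpace ℂ (Fin n)) = n := by simp
  have h1 := (Matrix.toEuclideanLin A).isSymmetric_adjoint_comp_self.roots_charpoly_eq_eigenvalues hn
  have h2 : (LinearMap.adjoint (Matrix.toEuclideanLin A) ∘ₗ Matrix.toEuclideanLin A).charpoly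
      = (A.conjTranspose * A).charpoly := by
    rw [← Matrix.toEuclideanLin_conjTranspose_eq_adjoint,
      Matrix.toEuclideanLin_eq_toLin_orthonormal, ← Matrix.toLin_mul, Matrix.charpoly_toLin]
  rw [← h2, h1, Multiset.map_map, singularValueSum]
  refine Finset.sum_congr rfl fun i _ => ?_
  rw [LinearMap.singularValues_fin _ hn]
  simp

/-- If `AᴴA = H²` with `H` Hermitian, the singular values of `A` are the absolute values of the
eigenvalues of `H`. -/
theorem singularValueSum_eq {n : ℕ} {A H : Matrix (Fin n) (Fin n) ℂ} (hH : H.IsHermitian)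
    (h : A.conjTranspose * A = H ^ 2) (F : ℝ → ℂ) :
    singularValueSum F A = ∑ i, F |hH.eigenvalues i| := by
  have h1 : (H ^ 2).charpoly
      = ∏ i, (Polynomial.X - Polynomial.C (((hH.eigenvalues i : ℝ) : ℂ) ^ 2)) := by
    conv_lhs => rw [hH.spectral_theorem]
    rw [← map_pow, Unitary.conjStarAlgAut_apply, Matrix.charpoly_mul_comm, ← mul_assoc,
      Unitary.coe_star_mul_self, one_mul, Matrix.diagonal_pow, Matrix.charpoly_diagonal]
    simp
  rw [singularValueSum_eq_roots, h, h1, Polynomial.roots_prod]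
  · simp only [Polynomial.roots_X_sub_C, Multiset.bind_singleton, Multiset.map_map,
      Function.comp_def, ← Complex.ofReal_pow, Complex.ofReal_re, Real.sqrt_sq_eq_abs]
    rfl
  · exact Finset.prod_ne_zero_iff.2 fun i _ => Polynomial.X_sub_C_ne_zero _

theorem roots_charpoly_of_const (z : ℂ) :
    (Matrix.of fun _ _ : Fin 1 => z).charpoly.roots = {z} := by
  have : (Matrix.of fun _ _ : Fin 1 => z) = Matrix.diagonal fun _ => z := by
    ext i j
    simp [Subsingleton.elim i j]
  rw [this, Matrix.charpoly_diagonal]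
  simp

theorem eigenvalueSum_scalar {X : Type*} (g : X → ℂ) (x : X) (F : ℂ → ℂ) :
    eigenvalueSum F (scalar g x) = F (g x) := by
  rw [eigenvalueSum, scalar, roots_charpoly_of_const]
  simp

theorem singularValueSum_scalar {X : Type*} (g : X → ℂ) (x : X) (F : ℝ → ℂ) :
    singularValueSum F (scalar g x) = F ‖g x‖ := by
  have h : (scalar g x).conjTranspose * scalar g x
      = Matrix.of fun _ _ => (((‖g x‖ ^ 2 : ℝ)) : ℂ) := by
    ext i j
    simp [scalar, Matrix.mul_apply, Complex.conj_mul']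
  rw [singularValueSum_eq_roots, h, roots_charpoly_of_const]
  simp only [Multiset.map_singleton, Multiset.sum_singleton, Complex.ofReal_re]
  rw [Real.sqrt_sq (norm_nonneg _)]

end FlippedToeplitz

/-! ### Trigonometric polynomials, uniqueness of Fourier coefficients, and density -/

namespace FlippedToeplitz

open scoped LaurentPolynomial Matrix.Norms.L2Operator

/-- Evaluation of a Laurent polynomial at `exp (i x)`. -/
noncomputable def trigEval (x : ℝ) : ℂ[T;T⁻¹] →+* ℂ :=
  LaurentPolynomial.eval₂ (RingHom.id ℂ) (Units.mk0 (Complex.exp (Complex.I * x)) (Complex.exp_ne_zero _))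

theorem trigEval_C_mul_T (x : ℝ) (c : ℂ) (k : ℤ) :
    trigEval x (LaurentPolynomial.C c * LaurentPolynomial.T k)
      = c * Complex.exp (Complex.I * k * x) := by
  rw [trigEval, LaurentPolynomial.eval₂_C_mul_T]
  simp only [RingHom.id_apply, Units.val_zpow_eq_zpow_val, Units.val_mk0]
  rw [← Complex.exp_int_mul]
  congr 2
  ring

theorem trigEval_eq_sum (x : ℝ) (p : ℂ[T;T⁻¹]) :
    trigEval x p = ∑ k ∈ p.coeff.support, p.coeff k * Complex.exp (Complex.I * k * x) := by
  have h : p = ∑ k ∈ p.coeff.support, LaurentPolynomial.C (p.coeff k) * LaurentPolynomial.T k := by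
    simp_rw [← LaurentPolynomial.single_eq_C_mul_T]
    exact (AddMonoidAlgebra.sum_coeff_single p).symm
  conv_lhs => rw [h]
  simp only [map_sum, trigEval_C_mul_T]

theorem continuous_trigEval (p : ℂ[T;T⁻¹]) : Continuous fun x => trigEval x p := by
  simp_rw [trigEval_eq_sum]
  fun_prop

theorem integral_exp_int (k : ℤ) :
    ∫ x in (-Real.pi)..Real.pi, Complex.exp (Complex.I * k * x)
      = if k = 0 then 2 * (Real.pi : ℂ) else 0 := by
  split_ifs with h
  · subst h
    simp
    ring
  · have hk : Complex.I * k ≠ 0 := by simp [h]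
    rw [integral_exp_mul_complex hk]
    have h1 : Complex.exp (Complex.I * k * (Real.pi : ℝ))
        = Complex.exp (Complex.I * k * ((-Real.pi : ℝ) : ℂ)) := by
      rw [Complex.exp_eq_exp_iff_exists_int]
      refine ⟨k, ?_⟩
      push_cast
      ring
    rw [h1, sub_self, zero_div]

/-- The mean of a trigonometric polynomial is its constant coefficient. -/
theorem mean_trigEval (p : ℂ[T;T⁻¹]) :
    (1 / (2 * (Real.pi : ℂ))) * ∫ x in (-Real.pi)..Real.pi, trigEval x p = p.coeff 0 := by
  simp_rw [trigEval_eq_sum]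
  rw [intervalIntegral.integral_finsetSum]
  · simp_rw [intervalIntegral.integral_const_mul, integral_exp_int, mul_ite, mul_zero]
    rw [Finset.sum_ite_eq']
    have : (Real.pi : ℂ) ≠ 0 := by exact_mod_cast Real.pi_ne_zero
    split_ifs with h
    · field_simp
    · rw [Finsupp.notMem_support_iff.1 h, mul_zero]
  · intro k _
    exact Continuous.intervalIntegrable (by fun_prop) _ _

theorem coeff_trigEval (p : ℂ[T;T⁻¹]) (k : ℤ) : coeff (fun x => trigEval x p) k = p.coeff k := by
  have h : ∀ x : ℝ, trigEval x p * Complex.exp (-(Complex.I * (k : ℂ) * (x : ℂ)))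
      = trigEval x (p * LaurentPolynomial.T (-k)) := by
    intro x
    have := trigEval_C_mul_T x 1 (-k)
    rw [map_one, one_mul, one_mul] at this
    rw [map_mul, this]
    congr 2
    push_cast
    ring
  rw [coeff]
  simp_rw [h]
  rw [mean_trigEval, coeff_mul_eq_sum]
  rw [Finset.sum_eq_single k]
  · rw [LaurentPolynomial.T, AddMonoidAlgebra.coeff_single, Finsupp.single_apply, if_pos (by omega),
      mul_one]
  · intro b _ hb
    rw [LaurentPolynomial.T, AddMonoidAlgebra.coeff_single, Finsupp.single_apply, if_neg, mul_zero]
    omega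
  · intro h
    rw [Finsupp.notMem_support_iff.1 h, zero_mul]

theorem coeff_sub_of_integrable {f g : ℝ → ℂ}
    (hf : IntervalIntegrable f volume (-Real.pi) Real.pi)
    (hg : IntervalIntegrable g volume (-Real.pi) Real.pi) (k : ℤ) :
    coeff (fun x => f x - g x) k = coeff f k - coeff g k := by
  have hc : ContinuousOn (fun x : ℝ => Complex.exp (-(Complex.I * (k : ℂ) * (x : ℂ))))
      (Set.uIcc (-Real.pi) Real.pi) := by fun_prop
  simp only [coeff, sub_mul]
  rw [intervalIntegral.integral_sub (hf.mul_continuousOn hc) (hg.mul_continuousOn hc), mul_sub]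

/-- The trace pairing of a Toeplitz matrix with a contraction is controlled by the `L¹` norm of
the symbol. -/
theorem norm_trace_toeplitz_mul_le {h : ℝ → ℂ}
    (hh : IntervalIntegrable h volume (-Real.pi) Real.pi) {n : ℕ} {C : Matrix (Fin n) (Fin n) ℂ}
    (hC : ‖C‖ ≤ 1) :
    ‖(toeplitz h n * C).trace‖
      ≤ n * ((1 / (2 * Real.pi)) * ∫ x in (-Real.pi)..Real.pi, ‖h x‖) := by
  -- Substituting the integral for each coefficient makes the trace the mean of h times the
  -- quadratic form of C at the exponential vector u(-x). That vector has squared norm n, so a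
  -- contraction gives a form of modulus at most n.
  let u : ℝ → EuclideanSpace ℂ (Fin n) := fun x =>
    WithLp.toLp 2 fun j => Complex.exp (Complex.I * (j : ℂ) * x)
  have hu : ∀ x, ‖u x‖ ^ 2 = n := by
    intro x
    rw [EuclideanSpace.norm_sq_eq]
    have : ∀ i : Fin n, ‖(u x) i‖ = 1 := by
      intro i
      have : Complex.I * (i : ℂ) * x = ((i * x : ℝ) : ℂ) * Complex.I := by push_cast; ring
      simp only [u, this]
      exact Complex.norm_exp_ofReal_mul_I _
    simp [this]
  let K : ℝ → ℂ := fun x => ∑ i : Fin n, ∑ j : Fin n,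
    Complex.exp (-(Complex.I * (((i : ℤ) - (j : ℤ) : ℤ) : ℂ) * (x : ℂ))) * C j i
  have hKc : Continuous K := by fun_prop
  have hq : ∀ x, K x = inner ℂ (u (-x)) (WithLp.toLp 2 (C.mulVec (u (-x)).ofLp)) := by
    intro x
    rw [PiLp.inner_apply]
    simp only [K]
    rw [Finset.sum_comm]
    refine Finset.sum_congr rfl fun j _ => ?_
    simp only [Matrix.mulVec, dotProduct, u, RCLike.inner_apply, Finset.sum_mul]
    refine Finset.sum_congr rfl fun i _ => ?_
    rw [← Complex.exp_conj, mul_assoc (C j i), ← Complex.exp_add, mul_comm]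
    congr 2
    simp
    ring
  have hqn : ∀ x, ‖K x‖ ≤ n := by
    intro x
    rw [hq]
    refine (norm_inner_le_norm _ _).trans ?_
    have h1 : ‖(WithLp.toLp 2 (C.mulVec (u (-x)).ofLp) : EuclideanSpace ℂ (Fin n))‖
        ≤ ‖C‖ * ‖u (-x)‖ := Matrix.l2_opNorm_mulVec C (u (-x))
    calc _ ≤ ‖u (-x)‖ * (1 * ‖u (-x)‖) := by gcongr; exact h1.trans (by gcongr)
      _ = n := by rw [one_mul, ← sq, hu]
  have htr : (toeplitz h n * C).trace = (1 / (2 * (Real.pi : ℂ))) *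
      ∫ x in (-Real.pi)..Real.pi, h x *
        K x := by
    have hint : ∀ i j : Fin n, IntervalIntegrable (fun x : ℝ => h x *
        (Complex.exp (-(Complex.I * (((i : ℤ) - (j : ℤ) : ℤ) : ℂ) * (x : ℂ))) * C j i)) volume
        (-Real.pi) Real.pi := by
      intro i j
      exact hh.mul_continuousOn (by fun_prop)
    simp only [K, Finset.mul_sum]
    have hint' : ∀ i ∈ (Finset.univ : Finset (Fin n)), IntervalIntegrable (fun x : ℝ => ∑ j : Fin n,
        h x * (Complex.exp (-(Complex.I * (((i : ℤ) - (j : ℤ) : ℤ) : ℂ) * (x : ℂ))) * C j i)) volume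
        (-Real.pi) Real.pi := fun i _ => by
      simp_rw [← Finset.mul_sum]
      exact hh.mul_continuousOn (by fun_prop)
    rw [intervalIntegral.integral_finsetSum hint', Finset.mul_sum]
    refine Finset.sum_congr rfl fun i _ => ?_
    rw [intervalIntegral.integral_finsetSum fun j _ => hint i j, Finset.mul_sum,
      Matrix.diag_apply, Matrix.mul_apply]
    refine Finset.sum_congr rfl fun j _ => ?_
    simp_rw [← mul_assoc]
    rw [intervalIntegral.integral_mul_const, toeplitz, Matrix.of_apply, coeff, mul_assoc]
  rw [htr, norm_mul]
  have h1 : ‖1 / (2 * (Real.pi : ℂ))‖ = 1 / (2 * Real.pi) := by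
    simp [abs_of_pos Real.pi_pos]
  have hpi : -Real.pi ≤ Real.pi := by linarith [Real.pi_pos]
  rw [h1, mul_left_comm]
  gcongr
  rw [← intervalIntegral.integral_const_mul]
  refine (intervalIntegral.norm_integral_le_integral_norm hpi).trans ?_
  refine intervalIntegral.integral_mono_on hpi (IntervalIntegrable.norm ?_)
    (hh.norm.const_mul _) fun x _ => ?_
  · exact hh.mul_continuousOn (by fun_prop)
  · rw [norm_mul, mul_comm]
    exact mul_le_mul_of_nonneg_right (hqn x) (norm_nonneg _)

/-- Continuous functions on the circle are uniform limits of trigonometric polynomials. -/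
theorem exists_trigEval_uniform [Fact (0 < 2 * Real.pi)] (φ : C(AddCircle (2 * Real.pi), ℂ)) {ε : ℝ}
    (hε : 0 < ε) : ∃ p : ℂ[T;T⁻¹], ∀ x : ℝ, ‖φ (x : AddCircle (2 * Real.pi)) - trigEval x p‖ ≤ ε := by
  have hmem : φ ∈ (Submodule.span ℂ (Set.range (@fourier (2 * Real.pi)))).topologicalClosure := by
    rw [span_fourier_closure_eq_top]
    trivial
  obtain ⟨q, hq, hdist⟩ := Metric.mem_closure_iff.1 hmem ε hε
  have hrep : ∃ p : ℂ[T;T⁻¹], ∀ x : ℝ, q (x : AddCircle (2 * Real.pi)) = trigEval x p := by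
    clear hdist
    induction hq using Submodule.span_induction with
    | mem y hy =>
      obtain ⟨k, rfl⟩ := hy
      refine ⟨LaurentPolynomial.C 1 * LaurentPolynomial.T k, fun x => ?_⟩
      rw [fourier_coe_apply, trigEval_C_mul_T, one_mul]
      congr 1
      have : (Real.pi : ℂ) ≠ 0 := by exact_mod_cast Real.pi_ne_zero
      push_cast
      field_simp
    | zero => exact ⟨0, fun x => by simp⟩
    | add y z _ _ hy hz =>
      obtain ⟨p, hp⟩ := hy
      obtain ⟨r, hr⟩ := hz
      exact ⟨p + r, fun x => by rw [ContinuousMap.add_apply, hp, hr, map_add]⟩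
    | smul c y _ hy =>
      obtain ⟨p, hp⟩ := hy
      refine ⟨LaurentPolynomial.C c * p, fun x => ?_⟩
      have := trigEval_C_mul_T x c 0
      rw [LaurentPolynomial.T_zero, mul_one] at this
      rw [ContinuousMap.smul_apply, hp, map_mul, this]
      simp
  obtain ⟨p, hp⟩ := hrep
  refine ⟨p, fun x => ?_⟩
  rw [← hp, ← dist_eq_norm]
  exact (ContinuousMap.dist_apply_le_dist _).trans hdist.le

theorem neg_pi_add_two_pi : -Real.pi + 2 * Real.pi = Real.pi := by ring

theorem neg_pi_le_pi : -Real.pi ≤ Real.pi := by linarith [Real.pi_pos]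

theorem integral_mul_trigEval_eq_zero {f : ℝ → ℂ}
    (hf : IntervalIntegrable f volume (-Real.pi) Real.pi) (h : ∀ k, coeff f k = 0) (p : ℂ[T;T⁻¹]) :
    ∫ x in (-Real.pi)..Real.pi, f x * trigEval x p = 0 := by
  simp_rw [trigEval_eq_sum, Finset.mul_sum]
  rw [intervalIntegral.integral_finsetSum fun k _ => hf.mul_continuousOn (by fun_prop)]
  refine Finset.sum_eq_zero fun k _ => ?_
  have h1 := h (-k)
  rw [coeff, mul_eq_zero] at h1
  have h2 := h1.resolve_left (by simp [Real.pi_ne_zero])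
  calc _ = p.coeff k * ∫ x in (-Real.pi)..Real.pi,
        f x * Complex.exp (-(Complex.I * ((-k : ℤ) : ℂ) * (x : ℂ))) := by
        rw [← intervalIntegral.integral_const_mul]
        refine intervalIntegral.integral_congr fun x _ => ?_
        simp only [Int.cast_neg, mul_neg, neg_mul, neg_neg]
        ring
    _ = 0 := by rw [h2, mul_zero]

/-- An integrable function on `[-π, π]` with vanishing Fourier coefficients is zero. -/
theorem ae_eq_zero_of_coeff_eq_zero {f : ℝ → ℂ}
    (hf : IntervalIntegrable f volume (-Real.pi) Real.pi) (h : ∀ k, coeff f k = 0) :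
    ∀ᵐ x, x ∈ Set.Ioo (-Real.pi) Real.pi → f x = 0 := by
  have : Fact (0 < 2 * Real.pi) := ⟨by positivity⟩
  have hf' : IntegrableOn f (Set.Ioc (-Real.pi) Real.pi) :=
    (intervalIntegrable_iff_integrableOn_Ioc_of_le neg_pi_le_pi).1 hf
  refine isOpen_Ioo.ae_eq_zero_of_integral_contDiff_smul_eq_zero
    (hf'.mono_set Set.Ioo_subset_Ioc_self).locallyIntegrableOn fun g hg _ hgs => ?_
  have hzero : ∀ x, x ∉ Set.Ioo (-Real.pi) Real.pi → g x = 0 := fun x hx =>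
    image_eq_zero_of_notMem_tsupport fun hx' => hx (hgs hx')
  -- A test function supported in the open interval vanishes at ±π, so it glues to a continuous
  -- function on the circle and can be approximated uniformly.
  have hcont : Continuous (AddCircle.liftIco (2 * Real.pi) (-Real.pi) fun x => ((g x : ℝ) : ℂ)) := by
    refine AddCircle.liftIco_continuous ?_ (Complex.continuous_ofReal.comp hg.continuous).continuousOn
    rw [neg_pi_add_two_pi, hzero _ (by simp), hzero _ (by simp)]
  have heq : ∀ x ∈ Set.Ioo (-Real.pi) Real.pi,
      AddCircle.liftIco (2 * Real.pi) (-Real.pi) (fun x => ((g x : ℝ) : ℂ)) x = g x := fun x hx => by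
    rw [AddCircle.liftIco_coe_apply]
    rw [neg_pi_add_two_pi]
    exact Set.Ioo_subset_Ico_self hx
  have hint : ∫ x, g x • f x = ∫ x in (-Real.pi)..Real.pi, f x * g x := by
    rw [intervalIntegral.integral_of_le neg_pi_le_pi, integral_Ioc_eq_integral_Ioo,
      ← setIntegral_eq_integral_of_forall_compl_eq_zero (s := Set.Ioo (-Real.pi) Real.pi)]
    · simp_rw [Complex.real_smul, mul_comm]
    · intro x hx
      rw [hzero x hx, zero_smul]
  rw [hint, ← norm_eq_zero]
  refine le_antisymm (le_of_forall_pos_le_add fun ε hε => ?_) (norm_nonneg _)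
  rw [zero_add]
  set J := ∫ x in (-Real.pi)..Real.pi, ‖f x‖ with hJ
  have hJ0 : 0 ≤ J := intervalIntegral.integral_nonneg neg_pi_le_pi fun _ _ => norm_nonneg _
  -- Dividing by J + 1 rather than J covers the case J = 0.
  obtain ⟨p, hp⟩ := exists_trigEval_uniform ⟨_, hcont⟩ (ε := ε / (J + 1)) (by positivity)
  have hgi : IntervalIntegrable (fun x => f x * g x) volume (-Real.pi) Real.pi :=
    hf.mul_continuousOn (Complex.continuous_ofReal.comp hg.continuous).continuousOn
  have hpi : IntervalIntegrable (fun x => f x * trigEval x p) volume (-Real.pi) Real.pi :=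
    hf.mul_continuousOn (continuous_trigEval p).continuousOn
  calc ‖∫ x in (-Real.pi)..Real.pi, f x * g x‖
      = ‖∫ x in (-Real.pi)..Real.pi, (f x * g x - f x * trigEval x p)‖ := by
        rw [intervalIntegral.integral_sub hgi hpi, integral_mul_trigEval_eq_zero hf h p, sub_zero]
    _ ≤ ∫ x in (-Real.pi)..Real.pi, ε / (J + 1) * ‖f x‖ := by
        refine intervalIntegral.norm_integral_le_of_norm_le neg_pi_le_pi ?_ (hf.norm.const_mul _)
        have hne : ∀ᵐ x : ℝ, x ≠ Real.pi := by simp [ae_iff]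
        filter_upwards [hne] with x hx hx'
        have hx'' : x ∈ Set.Ioo (-Real.pi) Real.pi := ⟨hx'.1, lt_of_le_of_ne hx'.2 hx⟩
        rw [← mul_sub, norm_mul, mul_comm, ← heq x hx'']
        exact mul_le_mul_of_nonneg_right (hp x) (norm_nonneg _)
    _ = ε * (J / (J + 1)) := by
        rw [intervalIntegral.integral_const_mul]
        ring
    _ ≤ ε := by
        refine mul_le_of_le_one_right hε.le ?_
        rw [div_le_one (by positivity)]
        linarith

/-- Trigonometric polynomials are dense in `L¹[-π, π]`. -/
theorem exists_trigEval_close {f : ℝ → ℂ}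
    (hf : IntervalIntegrable f volume (-Real.pi) Real.pi) {ε : ℝ} (hε : 0 < ε) :
    ∃ p : ℂ[T;T⁻¹], ∫ x in (-Real.pi)..Real.pi, ‖f x - trigEval x p‖ ≤ ε := by
  have : Fact (0 < 2 * Real.pi) := ⟨by positivity⟩
  have hf' : IntegrableOn f (Set.Ioc (-Real.pi) Real.pi) :=
    (intervalIntegrable_iff_integrableOn_Ioc_of_le neg_pi_le_pi).1 hf
  have hL : Integrable (AddCircle.liftIoc (2 * Real.pi) (-Real.pi) f) := by
    rw [← memLp_one_iff_integrable]
    refine MemLp.memLp_liftIoc ?_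
    rw [neg_pi_add_two_pi]
    exact memLp_one_iff_integrable.2 hf'
  -- Half of ε pays for a continuous approximation on the circle. A uniform error ε/(4π) on an
  -- interval of length 2π pays the other half.
  obtain ⟨g, hg, hgi⟩ := hL.exists_boundedContinuous_integral_sub_le (ε := ε / 2) (by positivity)
  obtain ⟨p, hp⟩ := exists_trigEval_uniform g.toContinuousMap (ε := ε / (4 * Real.pi)) (by positivity)
  refine ⟨p, ?_⟩
  have hgc : Continuous fun x : ℝ => g (x : AddCircle (2 * Real.pi)) :=
    g.continuous.comp (AddCircle.continuous_mk' _)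
  have h1 : ∫ x in (-Real.pi)..Real.pi, ‖f x - g (x : AddCircle (2 * Real.pi))‖ ≤ ε / 2 := by
    have h2 := AddCircle.intervalIntegral_preimage (2 * Real.pi) (-Real.pi)
      fun b => ‖AddCircle.liftIoc (2 * Real.pi) (-Real.pi) f b - g b‖
    rw [neg_pi_add_two_pi] at h2
    rw [← h2] at hg
    refine le_of_eq_of_le (intervalIntegral.integral_congr_ae (ae_of_all _ fun x hx => ?_)) hg
    rw [Set.uIoc_of_le neg_pi_le_pi] at hx
    rw [AddCircle.liftIoc_coe_apply]
    rwa [neg_pi_add_two_pi]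
  have hi1 : IntervalIntegrable (fun x => ‖f x - g (x : AddCircle (2 * Real.pi))‖) volume
      (-Real.pi) Real.pi := (hf.sub (hgc.intervalIntegrable _ _)).norm
  have hi2 : IntervalIntegrable (fun x => ‖f x - trigEval x p‖) volume
      (-Real.pi) Real.pi := (hf.sub ((continuous_trigEval p).intervalIntegrable _ _)).norm
  calc ∫ x in (-Real.pi)..Real.pi, ‖f x - trigEval x p‖
      ≤ ∫ x in (-Real.pi)..Real.pi,
          (‖f x - g (x : AddCircle (2 * Real.pi))‖ + ε / (4 * Real.pi)) := by
        refine intervalIntegral.integral_mono_on neg_pi_le_pi hi2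
          (hi1.add intervalIntegrable_const) fun x _ => ?_
        refine (norm_sub_le_norm_sub_add_norm_sub _ (g (x : AddCircle (2 * Real.pi))) _).trans ?_
        exact add_le_add_right (hp x) _
    _ ≤ ε / 2 + (Real.pi - -Real.pi) * (ε / (4 * Real.pi)) := by
        rw [intervalIntegral.integral_add hi1 intervalIntegrable_const,
          intervalIntegral.integral_const, smul_eq_mul]
        gcongr
    _ = ε := by
        have := Real.pi_ne_zero
        field_simp
        ring

end FlippedToeplitz

/-! ### Symmetric approximation, and eigenvalue limits for integrable symbols -/

namespace FlippedToeplitz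

open scoped LaurentPolynomial Matrix.Norms.L2Operator ComplexConjugate

theorem trigEval_invert (x : ℝ) (p : ℂ[T;T⁻¹]) :
    trigEval x (LaurentPolynomial.invert p) = trigEval (-x) p := by
  induction p using LaurentPolynomial.induction_on' with
  | add p q hp hq => rw [map_add, map_add, map_add, hp, hq]
  | C_mul_T k c =>
    rw [map_mul, LaurentPolynomial.invert_C, LaurentPolynomial.invert_T, trigEval_C_mul_T,
      trigEval_C_mul_T]
    push_cast
    congr 2
    ring

theorem norm_trigEval_le (x : ℝ) (p : ℂ[T;T⁻¹]) :
    ‖trigEval x p‖ ≤ ∑ k ∈ p.coeff.support, ‖p.coeff k‖ := by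
  rw [trigEval_eq_sum]
  refine norm_sum_le_of_le _ fun k _ => ?_
  have : Complex.I * k * x = ((k * x : ℝ) : ℂ) * Complex.I := by push_cast; ring
  rw [norm_mul, this, Complex.norm_exp_ofReal_mul_I, mul_one]

theorem conj_mul_exp (c : ℂ) (k : ℤ) (x : ℝ) :
    conj (c * Complex.exp (Complex.I * k * ((-x : ℝ) : ℂ)))
      = conj c * Complex.exp (Complex.I * k * x) := by
  rw [map_mul, ← Complex.exp_conj]
  congr 2
  simp

theorem trigEval_neg {p : ℂ[T;T⁻¹]} (hp : ∀ k, (p.coeff k).im = 0) (x : ℝ) :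
    trigEval (-x) p = conj (trigEval x p) := by
  have h : trigEval x p = conj (trigEval (-x) p) := by
    rw [trigEval_eq_sum, trigEval_eq_sum, map_sum]
    refine Finset.sum_congr rfl fun k _ => ?_
    rw [conj_mul_exp, Complex.conj_eq_iff_im.2 (hp k)]
  rw [h, Complex.conj_conj]

/-- The Laurent polynomial whose coefficients are the real parts of those of `p`. -/
noncomputable def reCoeff (p : ℂ[T;T⁻¹]) : ℂ[T;T⁻¹] :=
  AddMonoidAlgebra.ofCoeff (p.coeff.mapRange (fun z => (z.re : ℂ)) (by simp))

theorem coeff_reCoeff (p : ℂ[T;T⁻¹]) (k : ℤ) : (reCoeff p).coeff k = ((p.coeff k).re : ℂ) := by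
  rw [reCoeff]
  exact Finsupp.mapRange_apply (hf := by simp)

/-- Taking real parts of the coefficients averages p with x ↦ conj p(-x). A target with the same
symmetry is therefore approximated no worse in mean. -/
theorem trigEval_reCoeff (x : ℝ) (p : ℂ[T;T⁻¹]) :
    trigEval x (reCoeff p) = (trigEval x p + conj (trigEval (-x) p)) / 2 := by
  have hsub : (reCoeff p).coeff.support ⊆ p.coeff.support := by
    intro k hk
    rw [Finsupp.mem_support_iff] at hk ⊢
    rintro h
    exact hk (by rw [coeff_reCoeff, h]; simp)
  rw [trigEval_eq_sum, trigEval_eq_sum, trigEval_eq_sum, map_sum, ← Finset.sum_add_distrib,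
    Finset.sum_div, Finset.sum_subset hsub]
  · refine Finset.sum_congr rfl fun k _ => ?_
    rw [conj_mul_exp, coeff_reCoeff, Complex.re_eq_add_conj]
    ring
  · intro k _ hk
    rw [Finsupp.notMem_support_iff.1 hk, zero_mul]

theorem intervalIntegrable_comp_neg {E : Type*} [NormedAddCommGroup E] {h : ℝ → E}
    (hh : IntervalIntegrable h volume (-Real.pi) Real.pi) :
    IntervalIntegrable (fun x => h (-x)) volume (-Real.pi) Real.pi := by
  simpa using ((IntervalIntegrable.iff_comp_neg).1 hh).symm

theorem integral_comp_neg_pi {E : Type*} [NormedAddCommGroup E] [NormedSpace ℝ E] (h : ℝ → E) :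
    ∫ x in (-Real.pi)..Real.pi, h (-x) = ∫ x in (-Real.pi)..Real.pi, h x := by
  rw [intervalIntegral.integral_comp_neg, neg_neg]

/-- If `‖u x‖` is dominated by the mean of `‖v x‖` and `‖v (-x)‖`, then its integral is at most
that of `‖v‖`. -/
theorem integral_norm_le_of_symmetrized {u v : ℝ → ℂ}
    (hu : IntervalIntegrable u volume (-Real.pi) Real.pi)
    (hv : IntervalIntegrable v volume (-Real.pi) Real.pi)
    (h : ∀ᵐ x, x ∈ Set.Ioo (-Real.pi) Real.pi → ‖u x‖ ≤ (‖v x‖ + ‖v (-x)‖) / 2) :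
    ∫ x in (-Real.pi)..Real.pi, ‖u x‖ ≤ ∫ x in (-Real.pi)..Real.pi, ‖v x‖ := by
  have hv' := intervalIntegrable_comp_neg hv.norm
  calc ∫ x in (-Real.pi)..Real.pi, ‖u x‖
      ≤ ∫ x in (-Real.pi)..Real.pi, (‖v x‖ + ‖v (-x)‖) / 2 := by
        refine intervalIntegral.integral_mono_ae_restrict neg_pi_le_pi hu.norm
          ((hv.norm.add hv').div_const 2) ?_
        rw [← restrict_Ioo_eq_restrict_Icc]
        exact (ae_restrict_iff' measurableSet_Ioo).2 h
    _ = ∫ x in (-Real.pi)..Real.pi, ‖v x‖ := by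
        rw [intervalIntegral.integral_div, intervalIntegral.integral_add hv.norm hv',
          integral_comp_neg_pi fun x => ‖v x‖]
        ring

theorem coeff_conj_comp_neg (f : ℝ → ℂ) (k : ℤ) :
    coeff (fun x => conj (f (-x))) k = conj (coeff f k) := by
  simp only [coeff]
  rw [map_mul, ← intervalIntegral.intervalIntegral_conj,
    ← integral_comp_neg_pi fun x => conj (f x * Complex.exp (-(Complex.I * (k : ℂ) * (x : ℂ))))]
  congr 1
  · rw [map_div₀, map_mul, map_one, Complex.conj_ofReal, Complex.conj_ofNat]
  · refine intervalIntegral.integral_congr fun x _ => ?_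
    simp only [map_mul, ← Complex.exp_conj]
    congr 2
    simp

theorem coeff_comp_neg (f : ℝ → ℂ) (k : ℤ) : coeff (fun x => f (-x)) k = coeff f (-k) := by
  simp only [coeff]
  rw [← integral_comp_neg_pi fun x => f x * Complex.exp (-(Complex.I * ((-k : ℤ) : ℂ) * (x : ℂ)))]
  congr 1
  refine intervalIntegral.integral_congr fun x _ => ?_
  simp

/-- The function x ↦ conj f(-x) has the conjugate coefficients, so uniqueness identifies it with f.
This is how real coefficients enter for symbols that are only integrable. -/
theorem eq_conj_comp_neg {f : ℝ → ℂ} (hf : IntervalIntegrable f volume (-Real.pi) Real.pi)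
    (h : ∀ k, (coeff f k).im = 0) :
    ∀ᵐ x, x ∈ Set.Ioo (-Real.pi) Real.pi → f x = conj (f (-x)) := by
  have hg : IntervalIntegrable (fun x => conj (f (-x))) volume (-Real.pi) Real.pi := by
    have := intervalIntegrable_comp_neg hf
    exact ⟨Complex.conjLIE.integrable_comp_iff.2 this.1, Complex.conjLIE.integrable_comp_iff.2 this.2⟩
  have h1 := ae_eq_zero_of_coeff_eq_zero (hf.sub hg) fun k => by
    refine (coeff_sub_of_integrable hf hg k).trans ?_
    rw [coeff_conj_comp_neg, Complex.conj_eq_iff_im.2 (h k), sub_self]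
  filter_upwards [h1] with x hx hx'
  exact sub_eq_zero.1 (hx hx')

theorem eq_comp_neg {f : ℝ → ℂ} (hf : IntervalIntegrable f volume (-Real.pi) Real.pi)
    (h : ∀ k, coeff f (-k) = coeff f k) :
    ∀ᵐ x, x ∈ Set.Ioo (-Real.pi) Real.pi → f x = f (-x) := by
  have hg := intervalIntegrable_comp_neg hf
  have h1 := ae_eq_zero_of_coeff_eq_zero (hf.sub hg) fun k => by
    refine (coeff_sub_of_integrable hf hg k).trans ?_
    rw [coeff_comp_neg, h, sub_self]
  filter_upwards [h1] with x hx hx'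
  exact sub_eq_zero.1 (hx hx')

theorem intervalIntegrable_sub_trigEval {f : ℝ → ℂ}
    (hf : IntervalIntegrable f volume (-Real.pi) Real.pi) (p : ℂ[T;T⁻¹]) :
    IntervalIntegrable (fun x => f x - trigEval x p) volume (-Real.pi) Real.pi :=
  hf.sub ((continuous_trigEval p).intervalIntegrable _ _)

/-- A function with real Fourier coefficients is an `L¹` limit of trigonometric polynomials with
real coefficients. -/
theorem exists_real_trigEval_close {f : ℝ → ℂ}
    (hf : IntervalIntegrable f volume (-Real.pi) Real.pi) (h : ∀ k, (coeff f k).im = 0)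
    {ε : ℝ} (hε : 0 < ε) :
    ∃ p : ℂ[T;T⁻¹], (∀ k, (p.coeff k).im = 0) ∧
      ∫ x in (-Real.pi)..Real.pi, ‖f x - trigEval x p‖ ≤ ε := by
  obtain ⟨p, hp⟩ := exists_trigEval_close hf hε
  refine ⟨reCoeff p, fun k => by rw [coeff_reCoeff, Complex.ofReal_im], le_trans
    (integral_norm_le_of_symmetrized (intervalIntegrable_sub_trigEval hf _)
      (intervalIntegrable_sub_trigEval hf p) ?_) hp⟩
  filter_upwards [eq_conj_comp_neg hf h] with x hx hx'
  have h1 : f x - trigEval x (reCoeff p)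
      = ((f x - trigEval x p) + conj (f (-x) - trigEval (-x) p)) / 2 := by
    rw [trigEval_reCoeff, map_sub, ← hx hx']
    ring
  rw [h1, norm_div, Complex.norm_two]
  gcongr
  exact (norm_add_le _ _).trans (by rw [Complex.norm_conj])

/-- A function with real symmetric Fourier coefficients is an `L¹` limit of trigonometric
polynomials with real symmetric coefficients. -/
theorem exists_even_trigEval_close {f : ℝ → ℂ}
    (hf : IntervalIntegrable f volume (-Real.pi) Real.pi) (h : ∀ k, (coeff f k).im = 0)
    (hs : ∀ k, coeff f (-k) = coeff f k) {ε : ℝ} (hε : 0 < ε) :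
    ∃ p : ℂ[T;T⁻¹], (∀ k, (p.coeff k).im = 0) ∧ (∀ k, p.coeff (-k) = p.coeff k) ∧
      ∫ x in (-Real.pi)..Real.pi, ‖f x - trigEval x p‖ ≤ ε := by
  obtain ⟨p, hreal, hp⟩ := exists_real_trigEval_close hf h hε
  -- Averaging with p(1/z) makes the coefficients symmetric and keeps them real. Since f is even
  -- almost everywhere, the distance to f does not grow.
  let q : ℂ[T;T⁻¹] := (1 / 2 : ℂ) • (p + LaurentPolynomial.invert p)
  have hq : ∀ k, q.coeff k = (p.coeff k + p.coeff (-k)) / 2 := by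
    intro k
    simp only [q, AddMonoidAlgebra.coeff_smul, AddMonoidAlgebra.coeff_add, Finsupp.smul_apply,
      Finsupp.add_apply, coeff_invert, smul_eq_mul]
    ring
  have hqe : ∀ x, trigEval x q = (trigEval x p + trigEval (-x) p) / 2 := by
    intro x
    have h1 := trigEval_C_mul_T x (1 / 2) 0
    rw [LaurentPolynomial.T_zero, mul_one] at h1
    rw [← trigEval_invert, show q = LaurentPolynomial.C (1 / 2) * (p + LaurentPolynomial.invert p) from
      LaurentPolynomial.smul_eq_C_mul _ _, map_mul, h1, map_add]
    simp
    ring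
  refine ⟨q, fun k => ?_, fun k => ?_, le_trans
    (integral_norm_le_of_symmetrized (intervalIntegrable_sub_trigEval hf _)
      (intervalIntegrable_sub_trigEval hf p) ?_) hp⟩
  · rw [hq, ← Complex.conj_eq_iff_im, map_div₀, map_add, Complex.conj_eq_iff_im.2 (hreal k),
      Complex.conj_eq_iff_im.2 (hreal (-k)), Complex.conj_ofNat]
  · rw [hq, hq, neg_neg, add_comm]
  · filter_upwards [eq_comp_neg hf hs] with x hx hx'
    have h1 : f x - trigEval x q
        = ((f x - trigEval x p) + (f (-x) - trigEval (-x) p)) / 2 := by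
      rw [hqe, ← hx hx']
      ring
    rw [h1, norm_div, Complex.norm_two]
    gcongr
    exact norm_add_le _ _

/-- Normalized Lebesgue measure on `(-π, π]`. -/
noncomputable def circleMeasure : Measure ℝ :=
  ENNReal.ofReal (1 / (2 * Real.pi)) • volume.restrict (Set.Ioc (-Real.pi) Real.pi)

instance : IsProbabilityMeasure circleMeasure := ⟨by
  rw [circleMeasure, Measure.smul_apply, Measure.restrict_apply_univ, Real.volume_Ioc, smul_eq_mul,
    ← ENNReal.ofReal_mul (by positivity), ← ENNReal.ofReal_one]
  congr 1
  have := Real.pi_ne_zero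
  field_simp
  ring⟩

theorem integral_circleMeasure {E : Type*} [NormedAddCommGroup E] [NormedSpace ℝ E] (g : ℝ → E) :
    ∫ x, g x ∂circleMeasure = (1 / (2 * Real.pi)) • ∫ x in (-Real.pi)..Real.pi, g x := by
  rw [circleMeasure, integral_smul_measure, ENNReal.toReal_ofReal (by positivity),
    intervalIntegral.integral_of_le neg_pi_le_pi]

theorem integrable_circleMeasure {E : Type*} [NormedAddCommGroup E] {g : ℝ → E}
    (hg : IntervalIntegrable g volume (-Real.pi) Real.pi) : Integrable g circleMeasure :=
  ((intervalIntegrable_iff_integrableOn_Ioc_of_le neg_pi_le_pi).1 hg).smul_measure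
    ENNReal.ofReal_ne_top

theorem norm_exchange_le (n : ℕ) : ‖exchange n‖ ≤ 1 := by
  rcases n.eq_zero_or_pos with rfl | hn
  · rw [Subsingleton.elim (exchange 0) 0]; simp
  have : NeZero n := ⟨hn.ne'⟩
  have hmem : exchange n ∈ unitary (Matrix (Fin n) (Fin n) ℂ) := by
    rw [Unitary.mem_iff, Matrix.star_eq_conjTranspose, conjTranspose_exchange, exchange_mul_self]
    exact ⟨rfl, rfl⟩
  exact (CStarRing.norm_of_mem_unitary hmem).le

theorem toeplitz_sub_toep {f : ℝ → ℂ} (hf : IntervalIntegrable f volume (-Real.pi) Real.pi)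
    (p : ℂ[T;T⁻¹]) (n : ℕ) :
    toeplitz f n - toep p.coeff n = toeplitz (fun x => f x - trigEval x p) n := by
  ext i j
  simp only [Matrix.sub_apply, toeplitz, toep, Matrix.of_apply]
  rw [coeff_sub_of_integrable hf ((continuous_trigEval p).intervalIntegrable _ _), coeff_trigEval]

/-- Transfer of limits of exponential sums from trigonometric polynomials to `L¹` symbols. The
matrices are Toeplitz matrices multiplied on the left by a contraction. -/
theorem tendsto_exp_of_trig_approx {f : ℝ → ℂ}
    (hf : IntervalIntegrable f volume (-Real.pi) Real.pi)
    {Y : (n : ℕ) → Matrix (Fin n) (Fin n) ℂ} (hY : ∀ n, ‖Y n‖ ≤ 1)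
    {A : (n : ℕ) → Matrix (Fin n) (Fin n) ℂ} (hA : ∀ n, A n = Y n * toeplitz f n)
    (hH : ∀ n, (A n).IsHermitian) {S : ℝ → ℂ → ℝ}
    (hS : ∀ x z w, |S x z - S x w| ≤ ‖z - w‖) (hSm : Measurable fun q : ℝ × ℂ => S q.1 q.2) (t : ℝ)
    (happrox : ∀ ε > 0, ∃ (p : ℂ[T;T⁻¹]) (B : (n : ℕ) → Matrix (Fin n) (Fin n) ℂ)
      (hp : ∀ n, (B n).IsHermitian), (∀ n, B n = Y n * toep p.coeff n) ∧
      ∫ x in (-Real.pi)..Real.pi, ‖f x - trigEval x p‖ ≤ ε ∧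
      Tendsto (fun n : ℕ => (1 / (n : ℂ)) *
          ∑ i, Complex.exp (t * (hp n).eigenvalues i * Complex.I)) atTop
        (𝓝 (∫ x, Complex.exp (t * S x (trigEval x p) * Complex.I) ∂circleMeasure))) :
    Tendsto (fun n : ℕ => (1 / (n : ℂ)) * ∑ i, Complex.exp (t * (hH n).eigenvalues i * Complex.I))
      atTop (𝓝 (∫ x, Complex.exp (t * S x (f x) * Complex.I) ∂circleMeasure)) := by
  -- `S x` turns a symbol value into a real eigenvalue level: the real part for Toeplitz matrices,
  -- the signed modulus for flipped ones. Being 1-Lipschitz, it carries closeness in mean over to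
  -- the levels.
  have hmeas : ∀ g : ℝ → ℂ, Integrable g circleMeasure →
      AEMeasurable (fun x => S x (g x)) circleMeasure := fun g hg =>
    hSm.comp_aemeasurable (aemeasurable_id.prodMk hg.aestronglyMeasurable.aemeasurable)
  have hfi := integrable_circleMeasure hf
  refine tendsto_exp_of_approx (l := fun n => (hH n).eigenvalues) (hmeas f hfi) t fun ε hε => ?_
  -- After normalization by 2π the error is ε/(|t| + 1). It stays below ε both alone, for the
  -- symbols, and multiplied by |t|, for the Duhamel estimate.
  obtain ⟨p, B, hp, hB, hclose, hlim⟩ := happrox (2 * Real.pi * (ε / (|t| + 1))) (by positivity)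
  have hpi : Integrable (fun x => trigEval x p) circleMeasure :=
    integrable_circleMeasure ((continuous_trigEval p).intervalIntegrable _ _)
  have hdi := integrable_circleMeasure (intervalIntegrable_sub_trigEval hf p)
  have hclose' : (1 / (2 * Real.pi)) * ∫ x in (-Real.pi)..Real.pi, ‖f x - trigEval x p‖
      ≤ ε / (|t| + 1) := by
    rw [one_div, inv_mul_le_iff₀ (by positivity)]
    exact hclose
  have hε' : ε / (|t| + 1) ≤ ε := div_le_self hε.le (by linarith [abs_nonneg t])
  have hSi : Integrable (fun x => S x (f x) - S x (trigEval x p)) circleMeasure :=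
    hdi.mono ((hmeas f hfi).sub (hmeas _ hpi)).aestronglyMeasurable
      (ae_of_all _ fun x => hS x _ _)
  refine ⟨fun n => (hp n).eigenvalues, fun x => S x (trigEval x p), hmeas _ hpi, fun n => ?_, hSi,
    ?_, hlim⟩
  · refine (norm_sum_exp_eigenvalues_sub_le (hH n) (hp n) (δ := n * (ε / (|t| + 1)))
      (fun C hC => ?_) t).trans ?_
    · rw [hA, hB, ← mul_sub, toeplitz_sub_toep hf, mul_assoc, Matrix.trace_mul_comm, mul_assoc]
      refine (norm_trace_toeplitz_mul_le (intervalIntegrable_sub_trigEval hf p)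
        ((norm_mul_le _ _).trans (mul_le_one₀ hC (norm_nonneg _) (hY n)))).trans ?_
      gcongr
    · rw [mul_assoc]
      gcongr
      rw [div_mul_eq_mul_div, div_le_iff₀ (by positivity)]
      nlinarith [abs_nonneg t]
  · calc ∫ x, |S x (f x) - S x (trigEval x p)| ∂circleMeasure
        ≤ ∫ x, ‖f x - trigEval x p‖ ∂circleMeasure :=
          integral_mono hSi.abs hdi.norm fun x => hS x _ _
      _ ≤ ε := by
          rw [integral_circleMeasure, smul_eq_mul]
          exact hclose'.trans hε'

theorem integral_trigEval_circleMeasure (p : ℂ[T;T⁻¹]) :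
    ∫ x, trigEval x p ∂circleMeasure = p.coeff 0 := by
  rw [integral_circleMeasure, ← mean_trigEval, Complex.real_smul]
  push_cast
  rfl

/-- Szegő's theorem for Toeplitz matrices with real symmetric Fourier coefficients. -/
theorem tendsto_average_toeplitz {f : ℝ → ℂ}
    (hf : IntervalIntegrable f volume (-Real.pi) Real.pi) (h : ∀ k, (coeff f k).im = 0)
    (hs : ∀ k, coeff f (-k) = coeff f k) (hH : ∀ n, (toeplitz f n).IsHermitian) {F : ℝ → ℂ}
    (hF : Continuous F) (hFb : ∃ C, ∀ x, ‖F x‖ ≤ C) :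
    Tendsto (fun n : ℕ => (1 / (n : ℂ)) * ∑ i, F ((hH n).eigenvalues i)) atTop
      (𝓝 (∫ x, F (f x).re ∂circleMeasure)) := by
  refine tendsto_average_of_tendsto_exp (g := fun x => (f x).re) (l := fun n => (hH n).eigenvalues)
    (Complex.measurable_re.comp_aemeasurable
      (integrable_circleMeasure hf).aestronglyMeasurable.aemeasurable) (fun t => ?_) hF hFb
  -- The identity is written as a squared exchange matrix so that its norm bound holds in size 0 as
  -- well.
  refine tendsto_exp_of_trig_approx hf (Y := fun n => exchange n * exchange n)
    (fun n => (norm_mul_le _ _).trans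
      (mul_le_one₀ (norm_exchange_le n) (norm_nonneg _) (norm_exchange_le n)))
    (fun n => by rw [exchange_mul_self, one_mul]) hH (S := fun _ z => z.re)
    (fun x z w => by rw [← Complex.sub_re]; exact Complex.abs_re_le_norm _)
    (Complex.measurable_re.comp measurable_snd) t fun ε hε => ?_
  obtain ⟨p, hp, hps, hclose⟩ := exists_even_trigEval_close hf h hs hε
  refine ⟨p, fun n => toep p.coeff n, isHermitian_toep hp hps,
    fun n => by rw [exchange_mul_self, one_mul], hclose, ?_⟩
  refine tendsto_exp_of_tendsto_pow (g := fun x => (trigEval x p).re)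
    (l := fun n => (isHermitian_toep hp hps n).eigenvalues) (Complex.continuous_re.comp (continuous_trigEval p)).measurable.aemeasurable
    (fun n i => abs_eigenvalues_le _ (fun i => sum_norm_toep_le p i) i)
    (fun x => (Complex.abs_re_le_norm _).trans (norm_trigEval_le x p)) (fun k => ?_) t
  simp only [sum_eigenvalues_pow]
  have hre : ∀ x, (((trigEval x p).re : ℝ) : ℂ) = trigEval x p := by
    intro x
    rw [← Complex.conj_eq_iff_re, ← trigEval_neg hp, ← trigEval_invert]
    congr 1
    ext k
    rw [coeff_invert, hps]
  simp_rw [hre, ← map_pow, integral_trigEval_circleMeasure]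
  exact tendsto_trace_toep_pow p k

/-- The eigenvalue distribution of flipped Toeplitz matrices with real Fourier coefficients. -/
theorem tendsto_average_flipped {f : ℝ → ℂ}
    (hf : IntervalIntegrable f volume (-Real.pi) Real.pi) (h : ∀ k, (coeff f k).im = 0)
    (hH : ∀ n, (flipped f n).IsHermitian) {F : ℝ → ℂ}
    (hF : Continuous F) (hFb : ∃ C, ∀ x, ‖F x‖ ≤ C) :
    Tendsto (fun n : ℕ => (1 / (n : ℂ)) * ∑ i, F ((hH n).eigenvalues i)) atTop
      (𝓝 (∫ x, F (if 0 ≤ x then ‖f x‖ else -‖f x‖) ∂circleMeasure)) := by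
  have hSm : Measurable fun q : ℝ × ℂ => if 0 ≤ q.1 then ‖q.2‖ else -‖q.2‖ :=
    Measurable.ite (measurableSet_le measurable_const measurable_fst) measurable_snd.norm
      measurable_snd.norm.neg
  refine tendsto_average_of_tendsto_exp (g := fun x => if 0 ≤ x then ‖f x‖ else -‖f x‖)
    (l := fun n => (hH n).eigenvalues)
    (hSm.comp_aemeasurable (aemeasurable_id.prodMk
      (integrable_circleMeasure hf).aestronglyMeasurable.aemeasurable)) (fun t => ?_) hF hFb
  refine tendsto_exp_of_trig_approx hf norm_exchange_le (fun n => rfl) hH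
    (S := fun x z => if 0 ≤ x then ‖z‖ else -‖z‖) (fun x z w => ?_) hSm t fun ε hε => ?_
  · split_ifs
    · exact abs_norm_sub_norm_le z w
    · rw [neg_sub_neg, abs_sub_comm]
      exact abs_norm_sub_norm_le z w
  obtain ⟨p, hp, hclose⟩ := exists_real_trigEval_close hf h hε
  have hherm := isHermitian_exchange_mul_toep hp
  have hgm : Measurable fun x : ℝ => if 0 ≤ x then ‖trigEval x p‖ else -‖trigEval x p‖ :=
    hSm.comp (measurable_id.prodMk (continuous_trigEval p).measurable)
  have hgM : ∀ x : ℝ, |if 0 ≤ x then ‖trigEval x p‖ else -‖trigEval x p‖| = ‖trigEval x p‖ := by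
    intro x
    split_ifs <;> simp
  refine ⟨p, _, hherm, fun n => rfl, hclose, ?_⟩
  refine tendsto_exp_of_tendsto_pow (l := fun n => (hherm n).eigenvalues) hgm.aemeasurable
    (fun n i => abs_eigenvalues_le _ (fun i => ?_) i)
    (fun x => (hgM x).trans_le (norm_trigEval_le x p)) (fun k => ?_) t
  · simp_rw [exchange_mul_apply]
    exact sum_norm_toep_le p _
  simp_rw [sum_eigenvalues_pow]
  obtain ⟨m, rfl | rfl⟩ := Nat.even_or_odd' k
  -- An even power forgets the sign. For real coefficients p(1/z) is the conjugate of p(z) on the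
  -- circle, so the integrand is a power of the squared modulus.
  · have hsq : ∀ x : ℝ, (((if 0 ≤ x then ‖trigEval x p‖ else -‖trigEval x p‖ : ℝ)) : ℂ) ^ (2 * m)
        = trigEval x ((LaurentPolynomial.invert p * p) ^ m) := by
      intro x
      rw [pow_mul, ← Complex.ofReal_pow, ← sq_abs, hgM, map_pow, map_mul, trigEval_invert,
        trigEval_neg hp, Complex.conj_mul', Complex.ofReal_pow]
    simp_rw [hsq, integral_trigEval_circleMeasure]
    exact tendsto_trace_flipped_pow_even p m
  -- The modulus of p is even, so the signed modulus is odd except at the single point 0.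
  · have hodd : ∫ x, (((if 0 ≤ x then ‖trigEval x p‖ else -‖trigEval x p‖ : ℝ)) : ℂ) ^ (2 * m + 1)
        ∂circleMeasure = 0 := by
      rw [integral_circleMeasure, smul_eq_zero]
      right
      rw [← self_eq_neg, ← intervalIntegral.integral_neg, ← integral_comp_neg_pi]
      refine intervalIntegral.integral_congr_ae ?_
      have hne : ∀ᵐ x : ℝ, x ≠ 0 := by simp [ae_iff]
      filter_upwards [hne] with x hx _
      rw [← Odd.neg_pow ⟨m, rfl⟩, ← Complex.ofReal_neg]
      congr 2
      rw [trigEval_neg hp, Complex.norm_conj]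
      rcases hx.lt_or_gt with hx | hx
      · rw [if_pos (by linarith), if_neg (by linarith), neg_neg]
      · rw [if_neg (by linarith), if_pos hx.le]
    rw [hodd]
    exact tendsto_trace_flipped_pow_odd p m

end FlippedToeplitz

/-! ### Folding the circle onto [0, π], and the four distribution results -/

namespace FlippedToeplitz

open scoped ComplexConjugate

theorem intervalIntegrable_comp_of_bounded {E : Type*} [NormedAddCommGroup E] [MeasurableSpace E]
    [BorelSpace E] {g : ℝ → E} {a b : ℝ} (hab : a ≤ b)
    (hg : AEMeasurable g (volume.restrict (Set.Icc a b)))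
    {F : E → ℂ} (hF : Continuous F) (hFb : ∃ C, ∀ x, ‖F x‖ ≤ C) :
    IntervalIntegrable (fun x => F (g x)) volume a b := by
  obtain ⟨C, hC⟩ := hFb
  rw [intervalIntegrable_iff_integrableOn_Icc_of_le hab]
  exact Integrable.of_bound (hF.measurable.comp_aemeasurable hg).aestronglyMeasurable C
    (ae_of_all _ fun x => hC _)

theorem integral_circleMeasure_eq_fold {G : ℝ → ℂ}
    (hG : IntervalIntegrable G volume (-Real.pi) Real.pi) :
    ∫ x, G x ∂circleMeasure
      = (1 / (2 * Real.pi : ℂ)) * ∫ x in (0 : ℝ)..Real.pi, (G x + G (-x)) := by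
  have hpi := Real.pi_pos
  have h0 : (0 : ℝ) ∈ Set.uIcc (-Real.pi) Real.pi := by
    rw [Set.uIcc_of_le neg_pi_le_pi]
    constructor <;> linarith
  have h1 : IntervalIntegrable G volume (-Real.pi) 0 :=
    hG.mono_set (Set.uIcc_subset_uIcc Set.left_mem_uIcc h0)
  have h2 : IntervalIntegrable G volume 0 Real.pi :=
    hG.mono_set (Set.uIcc_subset_uIcc h0 Set.right_mem_uIcc)
  have h3 : IntervalIntegrable (fun x => G (-x)) volume 0 Real.pi := by
    simpa using ((IntervalIntegrable.iff_comp_neg).1 h1).symm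
  have h4 := intervalIntegral.integral_comp_neg (a := 0) (b := Real.pi) G
  rw [neg_zero] at h4
  rw [integral_circleMeasure, intervalIntegral.integral_add h2 h3, h4, add_comm,
    intervalIntegral.integral_add_adjacent_intervals h1 h2, Complex.real_smul]
  push_cast
  rfl

theorem aemeasurable_psi {g : ℝ → ℂ}
    (hg : AEMeasurable g (volume.restrict (Set.Icc 0 Real.pi))) :
    AEMeasurable (psi g) (volume.restrict (Set.Icc 0 (2 * Real.pi))) := by
  refine ⟨psi (hg.mk g), ?_, ?_⟩
  · exact Measurable.ite measurableSet_Iic hg.measurable_mk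
      (hg.measurable_mk.comp (measurable_id.sub_const _)).neg
  · have h1 := (ae_restrict_iff' measurableSet_Icc).1 hg.ae_eq_mk
    have h2 := (measurePreserving_sub_right volume Real.pi).quasiMeasurePreserving.ae h1
    refine (ae_restrict_iff' measurableSet_Icc).2 ?_
    filter_upwards [h1, h2] with x hx1 hx2 hx
    simp only [psi]
    split_ifs with h
    · exact hx1 ⟨hx.1, h⟩
    · rw [hx2 ⟨by linarith, by linarith [hx.2]⟩]

/-- Translating the second half of [0, 2π] back by π leaves an integral that depends only on the
unordered pair {g, -g}. This is why `f` and its modulus can serve equally well in `psi`. -/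
theorem integral_psi {g : ℝ → ℂ} (hg : AEMeasurable g (volume.restrict (Set.Icc 0 Real.pi)))
    {F : ℂ → ℂ} (hF : Continuous F) (hFb : ∃ C, ∀ x, ‖F x‖ ≤ C) :
    ∫ x in Set.Icc 0 (2 * Real.pi), F (psi g x)
      = ∫ x in (0 : ℝ)..Real.pi, (F (g x) + F (-g x)) := by
  have hpi := Real.pi_pos
  have h := intervalIntegrable_comp_of_bounded (by linarith) (aemeasurable_psi hg) hF hFb
  have hmem : Real.pi ∈ Set.uIcc 0 (2 * Real.pi) := by
    rw [Set.uIcc_of_le (by linarith)]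
    constructor <;> linarith
  have h1 := h.mono_set (Set.uIcc_subset_uIcc Set.left_mem_uIcc hmem)
  have h2 := h.mono_set (Set.uIcc_subset_uIcc hmem Set.right_mem_uIcc)
  have hneg : IntervalIntegrable (fun x => F (-g x)) volume 0 Real.pi :=
    intervalIntegrable_comp_of_bounded hpi.le hg.neg hF hFb
  rw [integral_Icc_eq_integral_Ioc, ← intervalIntegral.integral_of_le (by linarith),
    ← intervalIntegral.integral_add_adjacent_intervals h1 h2,
    intervalIntegral.integral_add (intervalIntegrable_comp_of_bounded hpi.le hg hF hFb) hneg]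
  congr 1
  · refine intervalIntegral.integral_congr fun x hx => ?_
    rw [Set.uIcc_of_le hpi.le] at hx
    simp only [psi, if_pos hx.2]
  · have h3 := intervalIntegral.integral_comp_sub_right (a := Real.pi) (b := 2 * Real.pi)
      (fun x => F (-g x)) Real.pi
    rw [sub_self, show 2 * Real.pi - Real.pi = Real.pi by ring] at h3
    rw [← h3]
    refine intervalIntegral.integral_congr_ae (ae_of_all _ fun x hx => ?_)
    rw [Set.uIoc_of_le (by linarith)] at hx
    rw [psi, if_neg (not_le.2 hx.1)]

theorem isSymbolSetting_scalar {g : ℝ → ℂ} {b : ℝ} (hb : 0 < b)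
    (hg : AEMeasurable g (volume.restrict (Set.Icc 0 b))) :
    IsSymbolSetting (fun n : ℕ => n) (Set.Icc 0 b) (scalar g) where
  tendsto_size := tendsto_id
  size_pos := one_pos
  nullMeasurableSet := measurableSet_Icc.nullMeasurableSet
  volume_pos := by simpa using hb
  volume_lt_top := by simp
  aemeasurable := fun _ _ => hg

theorem volume_real_Icc_zero {b : ℝ} (hb : 0 ≤ b) : volume.real (Set.Icc 0 b) = b := by
  rw [Measure.real, Real.volume_Icc, sub_zero, ENNReal.toReal_ofReal hb]

/-- The endpoint π is discarded as a null set. Strict positivity is recorded because it selects the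
sign branch of the symbol at x and at -x. -/
theorem ae_Ioo_of_ae_symm {P : ℝ → Prop}
    (h : ∀ᵐ x, x ∈ Set.Ioo (-Real.pi) Real.pi → P x) :
    ∀ᵐ x, x ∈ Set.uIoc 0 Real.pi → 0 < x ∧ P x := by
  have hne : ∀ᵐ x : ℝ, x ≠ Real.pi := by simp [ae_iff]
  filter_upwards [h, hne] with x hx hx' hmem
  rw [Set.uIoc_of_le Real.pi_pos.le] at hmem
  exact ⟨hmem.1, hx ⟨by linarith [hmem.1, Real.pi_pos], lt_of_le_of_ne hmem.2 hx'⟩⟩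

theorem exists_norm_le_of_hasCompactSupport {E : Type*} [TopologicalSpace E] {F : E → ℂ}
    (hF : Continuous F) (hFc : HasCompactSupport F) : ∃ C, ∀ x, ‖F x‖ ≤ C :=
  hF.bounded_above_of_compact_support hFc

theorem isHermitian_flipped {f : ℝ → ℂ} (h : ∀ k, (coeff f k).im = 0) (n : ℕ) :
    (flipped f n).IsHermitian :=
  isHermitian_exchange_mul_toep h n

theorem flipped_conjTranspose_mul_self {f : ℝ → ℂ} (n : ℕ) :
    (flipped f n).conjTranspose * flipped f n = (toeplitz f n).conjTranspose * toeplitz f n := by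
  rw [flipped, Matrix.conjTranspose_mul, conjTranspose_exchange, mul_assoc,
    ← mul_assoc (exchange n), exchange_mul_self, one_mul]

/-- The singular value distribution of matrices with the same Gram matrices as the flipped Toeplitz
matrices of a symbol with real Fourier coefficients. -/
theorem hasSingularValueSymbol_of_gram_eq {f : ℝ → ℂ}
    (hf : IntegrableOn f (Set.Icc (-Real.pi) Real.pi)) (h : ∀ k, (coeff f k).im = 0)
    {A : (n : ℕ) → Matrix (Fin n) (Fin n) ℂ}
    (hA : ∀ n, (A n).conjTranspose * A n = (flipped f n).conjTranspose * flipped f n) :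
    HasSingularValueSymbol A (Set.Icc 0 Real.pi) (scalar f) := by
  have hpi := Real.pi_pos
  have hfi : IntervalIntegrable f volume (-Real.pi) Real.pi :=
    (intervalIntegrable_iff_integrableOn_Icc_of_le neg_pi_le_pi).2 hf
  have hsub : Set.Icc 0 Real.pi ⊆ Set.Icc (-Real.pi) Real.pi := Set.Icc_subset_Icc_left (by linarith)
  refine ⟨isSymbolSetting_scalar hpi (hf.mono_set hsub).aemeasurable, fun F hF hFc => ?_⟩
  have hFb := exists_norm_le_of_hasCompactSupport hF hFc
  have hH := isHermitian_flipped h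
  -- Testing against F(|·|) turns eigenvalues into singular values and removes the sign from the
  -- symbol.
  have hlim := tendsto_average_flipped (F := fun x => F |x|) hfi h hH (hF.comp continuous_abs)
    (hFb.imp fun C hC x => hC |x|)
  have hsum : ∀ n, singularValueSum F (A n) = ∑ i, F |(hH n).eigenvalues i| := fun n =>
    singularValueSum_eq (hH n) (by rw [hA, (hH n).eq, sq]) F
  simp_rw [hsum, singularValueSum_scalar, Nat.cast_one, div_one, volume_real_Icc_zero hpi.le]
  convert hlim using 2
  have habs : ∀ x, F |if 0 ≤ x then ‖f x‖ else -‖f x‖| = F ‖f x‖ := by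
    intro x
    split_ifs <;> simp
  simp_rw [habs]
  rw [integral_circleMeasure_eq_fold
    (intervalIntegrable_comp_of_bounded neg_pi_le_pi hf.aemeasurable.norm hF hFb),
    integral_Icc_eq_integral_Ioc, ← intervalIntegral.integral_of_le hpi.le]
  -- The modulus of f is even, so both halves contribute equally; the factor 2 changes 1/(2π) into
  -- 1/π.
  have hsymm : ∫ x in (0 : ℝ)..Real.pi, (F ‖f x‖ + F ‖f (-x)‖)
      = ∫ x in (0 : ℝ)..Real.pi, 2 * F ‖f x‖ := by
    refine intervalIntegral.integral_congr_ae ?_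
    filter_upwards [ae_Ioo_of_ae_symm (eq_conj_comp_neg hfi h)] with x hx hmem
    rw [(hx hmem).2, Complex.norm_conj, two_mul]
  rw [hsymm, intervalIntegral.integral_const_mul]
  have : (Real.pi : ℂ) ≠ 0 := by exact_mod_cast hpi.ne'
  field_simp

/-- Symmetric coefficients make f even, and real ones make f(x) the conjugate of f(-x). Together
they force f to be real. -/
theorem ae_real_and_even {f : ℝ → ℂ} (hfi : IntervalIntegrable f volume (-Real.pi) Real.pi)
    (h : ∀ k, (coeff f k).im = 0) (hs : ∀ k, coeff f (-k) = coeff f k) :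
    ∀ᵐ x, x ∈ Set.uIoc 0 Real.pi → 0 < x ∧ ((f x).re : ℂ) = f x ∧ f (-x) = f x := by
  filter_upwards [ae_Ioo_of_ae_symm (eq_conj_comp_neg hfi h),
    ae_Ioo_of_ae_symm (eq_comp_neg hfi hs)] with x h1 h2 hmem
  have h3 := (h1 hmem).2
  have h4 := (h2 hmem).2
  refine ⟨(h1 hmem).1, ?_, h4.symm⟩
  rw [← h4] at h3
  exact Complex.conj_eq_iff_re.1 h3.symm

theorem hasEigenvalueSymbol_toeplitz {f : ℝ → ℂ}
    (hf : IntegrableOn f (Set.Icc (-Real.pi) Real.pi)) (h : ∀ k, (coeff f k).im = 0)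
    (hs : ∀ k, coeff f (-k) = coeff f k) :
    HasEigenvalueSymbol (fun n => toeplitz f n) (Set.Icc 0 Real.pi) (scalar f) := by
  have hpi := Real.pi_pos
  have hfi : IntervalIntegrable f volume (-Real.pi) Real.pi :=
    (intervalIntegrable_iff_integrableOn_Icc_of_le neg_pi_le_pi).2 hf
  have hsub : Set.Icc 0 Real.pi ⊆ Set.Icc (-Real.pi) Real.pi := Set.Icc_subset_Icc_left (by linarith)
  refine ⟨isSymbolSetting_scalar hpi (hf.mono_set hsub).aemeasurable, fun F hF hFc => ?_⟩
  have hFb := exists_norm_le_of_hasCompactSupport hF hFc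
  have hH : ∀ n, (toeplitz f n).IsHermitian := isHermitian_toep h hs
  have hF' : Continuous fun x : ℝ => F x := hF.comp Complex.continuous_ofReal
  have hFb' : ∃ C, ∀ x : ℝ, ‖F x‖ ≤ C := hFb.imp fun C hC x => hC x
  have hlim := tendsto_average_toeplitz hfi h hs hH hF' hFb'
  have hsum : ∀ n, eigenvalueSum F (toeplitz f n) = ∑ i, F ((hH n).eigenvalues i) := fun n =>
    eigenvalueSum_eq (hH n) F
  simp_rw [hsum, eigenvalueSum_scalar, Nat.cast_one, div_one, volume_real_Icc_zero hpi.le]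
  convert hlim using 2
  rw [integral_circleMeasure_eq_fold
    (intervalIntegrable_comp_of_bounded (F := fun x : ℝ => F x) (g := fun x => (f x).re) neg_pi_le_pi
      (Complex.measurable_re.comp_aemeasurable hf.aemeasurable) hF' hFb'),
    integral_Icc_eq_integral_Ioc, ← intervalIntegral.integral_of_le hpi.le]
  have hsymm : ∫ x in (0 : ℝ)..Real.pi, (F ((f x).re : ℂ) + F ((f (-x)).re : ℂ))
      = ∫ x in (0 : ℝ)..Real.pi, 2 * F (f x) := by
    refine intervalIntegral.integral_congr_ae ?_
    filter_upwards [ae_real_and_even hfi h hs] with x hx hmem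
    obtain ⟨-, hre, heven⟩ := hx hmem
    rw [heven, hre, two_mul]
  rw [hsymm, intervalIntegral.integral_const_mul]
  have : (Real.pi : ℂ) ≠ 0 := by exact_mod_cast hpi.ne'
  field_simp

/-- The eigenvalue distribution of flipped Toeplitz matrices is described by `ψ_g` for every `g`
which agrees with `f` up to signs on `[0, π]`. -/
theorem hasEigenvalueSymbol_flipped {f g : ℝ → ℂ}
    (hf : IntegrableOn f (Set.Icc (-Real.pi) Real.pi)) (h : ∀ k, (coeff f k).im = 0)
    (hg : AEMeasurable g (volume.restrict (Set.Icc 0 Real.pi)))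
    (hfg : ∀ᵐ x, x ∈ Set.uIoc 0 Real.pi → g x = (‖f x‖ : ℂ) ∨ g x = -(‖f x‖ : ℂ)) :
    HasEigenvalueSymbol (fun n => flipped f n) (Set.Icc 0 (2 * Real.pi)) (scalar (psi g)) := by
  have hpi := Real.pi_pos
  have hfi : IntervalIntegrable f volume (-Real.pi) Real.pi :=
    (intervalIntegrable_iff_integrableOn_Icc_of_le neg_pi_le_pi).2 hf
  refine ⟨isSymbolSetting_scalar (by positivity) (aemeasurable_psi hg), fun F hF hFc => ?_⟩
  have hFb := exists_norm_le_of_hasCompactSupport hF hFc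
  have hH := isHermitian_flipped h
  have hF' : Continuous fun x : ℝ => F x := hF.comp Complex.continuous_ofReal
  have hFb' : ∃ C, ∀ x : ℝ, ‖F x‖ ≤ C := hFb.imp fun C hC x => hC x
  have hlim := tendsto_average_flipped hfi h hH hF' hFb'
  have hsum : ∀ n, eigenvalueSum F (flipped f n) = ∑ i, F ((hH n).eigenvalues i) := fun n =>
    eigenvalueSum_eq (hH n) F
  simp_rw [hsum, eigenvalueSum_scalar, Nat.cast_one, div_one,
    volume_real_Icc_zero (by positivity : 0 ≤ 2 * Real.pi)]
  convert hlim using 2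
  have hmeas : AEMeasurable (fun x => if 0 ≤ x then ‖f x‖ else -‖f x‖)
      (volume.restrict (Set.Icc (-Real.pi) Real.pi)) :=
    (Measurable.ite (measurableSet_le measurable_const measurable_fst) measurable_snd.norm
      measurable_snd.norm.neg : Measurable fun q : ℝ × ℂ => if 0 ≤ q.1 then ‖q.2‖ else -‖q.2‖)
      |>.comp_aemeasurable (aemeasurable_id.prodMk hf.aemeasurable)
  rw [integral_circleMeasure_eq_fold
    (intervalIntegrable_comp_of_bounded (F := fun x : ℝ => F x) neg_pi_le_pi hmeas hF' hFb'),
    integral_psi hg hF hFb]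
  congr 1
  · push_cast
    rfl
  refine intervalIntegral.integral_congr_ae ?_
  filter_upwards [hfg, ae_Ioo_of_ae_symm (eq_conj_comp_neg hfi h)] with x hx hx' hmem
  obtain ⟨hpos, hconj⟩ := hx' hmem
  have hnorm : ‖f (-x)‖ = ‖f x‖ := by rw [hconj, Complex.norm_conj]
  rw [if_pos hpos.le, if_neg (by linarith), hnorm, Complex.ofReal_neg]
  -- With either sign, g and -g are the modulus of f and its negative; the second case only swaps
  -- the two summands.
  rcases hx hmem with hx | hx
  · rw [hx]
  · rw [hx, neg_neg, add_comm]

end FlippedToeplitz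

theorem theorem3p6 (f : ℝ → ℂ)
    (hf : MeasureTheory.IntegrableOn f (Set.Icc (-Real.pi) Real.pi)) :
    ((∀ k : ℤ, (FlippedToeplitz.coeff f k).im = 0) →
      FlippedToeplitz.HasSingularValueSymbol (fun n => FlippedToeplitz.toeplitz f n)
          (Set.Icc 0 Real.pi) (FlippedToeplitz.scalar f) ∧
        FlippedToeplitz.HasSingularValueSymbol (fun n => FlippedToeplitz.flipped f n)
          (Set.Icc 0 Real.pi) (FlippedToeplitz.scalar f)) ∧
    ((∀ k : ℤ, (FlippedToeplitz.coeff f k).im = 0 ∧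
        FlippedToeplitz.coeff f (-k) = FlippedToeplitz.coeff f k) →
      FlippedToeplitz.HasEigenvalueSymbol (fun n => FlippedToeplitz.toeplitz f n)
          (Set.Icc 0 Real.pi) (FlippedToeplitz.scalar f) ∧
        FlippedToeplitz.HasEigenvalueSymbol (fun n => FlippedToeplitz.flipped f n)
          (Set.Icc 0 (2 * Real.pi))
          (FlippedToeplitz.scalar (FlippedToeplitz.psi f)) ∧
        FlippedToeplitz.HasEigenvalueSymbol (fun n => FlippedToeplitz.flipped f n)
          (Set.Icc 0 (2 * Real.pi))
          (FlippedToeplitz.scalar (FlippedToeplitz.psi fun x => ((‖f x‖ : ℝ) : ℂ)))) := by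
  have hfi : IntervalIntegrable f MeasureTheory.volume (-Real.pi) Real.pi :=
    (intervalIntegrable_iff_integrableOn_Icc_of_le FlippedToeplitz.neg_pi_le_pi).2 hf
  have hfm : AEMeasurable f (MeasureTheory.volume.restrict (Set.Icc 0 Real.pi)) :=
    (hf.mono_set (Set.Icc_subset_Icc_left (by linarith [Real.pi_pos]))).aemeasurable
  refine ⟨fun h => ⟨?_, ?_⟩, fun h => ?_⟩
  · exact FlippedToeplitz.hasSingularValueSymbol_of_gram_eq hf h fun n =>
      (FlippedToeplitz.flipped_conjTranspose_mul_self n).symm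
  · exact FlippedToeplitz.hasSingularValueSymbol_of_gram_eq hf h fun n => rfl
  · have hre := fun k => (h k).1
    have hs := fun k => (h k).2
    refine ⟨FlippedToeplitz.hasEigenvalueSymbol_toeplitz hf hre hs,
      FlippedToeplitz.hasEigenvalueSymbol_flipped hf hre hfm ?_,
      FlippedToeplitz.hasEigenvalueSymbol_flipped hf hre
        (Complex.measurable_ofReal.comp_aemeasurable hfm.norm) (ae_of_all _ fun x _ => Or.inl rfl)⟩
    -- Here f is real almost everywhere, hence equal to plus or minus its modulus.
    filter_upwards [FlippedToeplitz.ae_real_and_even hfi hre hs] with x hx hmem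
    have hreal := (hx hmem).2.1
    rw [← hreal, Complex.norm_real, Real.norm_eq_abs]
    rcases abs_choice (f x).re with h1 | h1
    · exact Or.inl (by rw [h1])
    · exact Or.inr (by rw [h1, Complex.ofReal_neg, neg_neg])
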